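/- Let $S$ be a set of $n\ge 2$ points in the Euclidean plane, no three collinear, each having one of $k\ge 2$ colors. An island is a set $I\subseteq S$, all of whose points have the same color, with $\mathrm{CH}(I)\cap S=I$, where $\mathrm{CH}$ is the convex hull. An island partition of $S$ is a family of nonempty islands with pairwise disjoint convex hulls that cover $S$; $\mathrm{Opt}_P$ is the minimum cardinality of an island partition of $S$. Bold overlap-greedy is the following algorithm. 1. (Overlap-greedy.) While some point of $S$ is uncovered, choose an island that covers the most uncovered points and, among those, one that covers the fewest previously covered points (remaining ties are broken arbitrarily). This gives islands $I_1,\dots,I_m$ covering $S$. 2. (Bold augmentations.) Start with the arrangement $A_0$ without faces. For $i=1,\dots,m$ obtain $A_i$ from $A_{i-1}$ by adding the boundary of $\mathrm{CH}(I_i)$ and merging everything inside $\mathrm{CH}(I_i)$ into one face. That is, the faces of $A_i$ are the relative interior of $\mathrm{CH}(I_i)$ (the interior if $|I_i|\ge 3$, a degenerate face if $|I_i|\le 2$) and the connected components of $F\setminus \mathrm{CH}(I_i)$ for the faces $F$ of $A_{i-1}$. 3. (Extraction.) Assign each point of $S$ to a face of $A_m$ whose closure contains it; return the family of the nonempty sets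 of points assigned to the same face. Corollary. Bold overlap-greedy has approximation ratio $O(\mathrm{Opt}_P^2\log^2 n)$. That is, there is an absolute constant $C>0$ such that, for all $k$ and all $S$ as above, the algorithm has an output, and every possible output $\mathcal P$ is an island partition of $S$ with $$|\mathcal P|\le C\,\mathrm{Opt}_P^2\,(\log n)^2\cdot \mathrm{Opt}_P .$$ -/

import Mathlib

namespace IslandPartition

/-- The Euclidean plane. -/
abbrev Plane : Type := EuclideanSpace ℝ (Fin 2)

/-- The convex hull of a finite set of points. -/
def hull (I : Finset Plane) : Set Plane := convexHull ℝ (I : Set Plane)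

/-- No three points of `S` are collinear. -/
def GeneralPosition (S : Finset Plane) : Prop :=
  ∀ T : Finset Plane, T ⊆ S → T.card = 3 → ¬ Collinear ℝ (T : Set Plane)

/-- A monochromatic island of the colored point set `S`: a subset `I` of `S` whose points all have
the same color and whose convex hull contains no further point of `S`. -/
structure IsIsland {k : ℕ} (S : Finset Plane) (color : Plane → Fin k) (I : Finset Plane) :
    Prop where
  subset : I ⊆ S
  hull_inter : hull I ∩ (S : Set Plane) = (I : Set Plane)
  monochromatic : ∀ p ∈ I, ∀ q ∈ I, color p = color q

/-- An island partition of `S`: a finite family of nonempty monochromatic islands that together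
contain all points of `S` and whose convex hulls are pairwise disjoint. -/
structure IsIslandPartition {k : ℕ} (S : Finset Plane) (color : Plane → Fin k)
    (P : Finset (Finset Plane)) : Prop where
  isIsland : ∀ I ∈ P, IsIsland S color I
  nonempty : ∀ I ∈ P, I.Nonempty
  disjoint_hull : ∀ I ∈ P, ∀ J ∈ P, I ≠ J → Disjoint (hull I) (hull J)
  covers : ∀ p ∈ S, ∃ I ∈ P, p ∈ I

/-- `Opt_P`, the minimum cardinality of an island partition of `S`. -/
noncomputable def optPartition {k : ℕ} (S : Finset Plane) (color : Plane → Fin k) : ℕ :=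
  sInf {r : ℕ | ∃ P : Finset (Finset Plane), IsIslandPartition S color P ∧ P.card = r}

open Classical in
/-- The points of `S` that are covered by the islands in the list `L`. -/
noncomputable def covered (S : Finset Plane) (L : List (Finset Plane)) : Finset Plane :=
  S.filter (fun p => ∃ I ∈ L, p ∈ I)

open Classical in
/-- `I` is a legal choice of overlap-greedy when the points of `U` are already covered: among all
monochromatic islands it covers the most uncovered points and, among those that do, it covers the
fewest previously covered points. (Remaining ties may be broken arbitrarily.) -/
structure IsGreedyChoice {k : ℕ} (S : Finset Plane) (color : Plane → Fin k)
    (U : Finset Plane) (I : Finset Plane) : Prop where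
  isIsland : IsIsland S color I
  max_new : ∀ J, IsIsland S color J → (J \ U).card ≤ (I \ U).card
  min_old : ∀ J, IsIsland S color J → (J \ U).card = (I \ U).card →
    (I ∩ U).card ≤ (J ∩ U).card

/-- The lists of islands that overlap-greedy may have chosen, in this order, at some moment of its
execution. It keeps choosing islands as long as some point of `S` is uncovered. -/
inductive OverlapGreedyRun {k : ℕ} (S : Finset Plane) (color : Plane → Fin k) :
    List (Finset Plane) → Prop
  | start : OverlapGreedyRun S color []
  | step (L : List (Finset Plane)) (I : Finset Plane) :
      OverlapGreedyRun S color L → covered S L ≠ S → IsGreedyChoice S color (covered S L) I →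
      OverlapGreedyRun S color (L ++ [I])

/-- `L` is an island cover `I₁, …, I_m` (in the order of choice) returned by overlap-greedy. -/
def OverlapGreedyReturns {k : ℕ} (S : Finset Plane) (color : Plane → Fin k)
    (L : List (Finset Plane)) : Prop :=
  OverlapGreedyRun S color L ∧ covered S L = S

/-- Bold augmentation by the island `I` of an arrangement, which is given by the set `A` of those of
its faces that lie in the convex hulls of its islands. Adding the boundary of the hull of `I` cuts
every face `F` into the connected components of its part outside the hull, and pieces inside the
hull; then the interior of the hull is turned into one single face.

If `I` has at least three points (not all collinear), the relative interior `intrinsicInterior` of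
its hull is the interior. An island with one or two points contributes the point itself or the open
segment, as a degenerate face. -/
def boldAugment (A : Set (Set Plane)) (I : Finset Plane) : Set (Set Plane) :=
  {intrinsicInterior ℝ (hull I)} ∪
    {G | ∃ F ∈ A, ∃ x ∈ F \ hull I, G = connectedComponentIn (F \ hull I) x}

/-- The faces of the arrangement of `I₁, …, I_m` that is obtained from the empty arrangement by
bold augmentation with `I₁`, then with `I₂`, and so on. -/
def boldArrangement (L : List (Finset Plane)) : Set (Set Plane) :=
  L.foldl boldAugment ∅

open Classical in
/-- `P` is extracted from the faces in `A`: each point of `S` is assigned to a face `f p` whose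
closure contains it, and each face to which some point is assigned yields the set of all points
assigned to it. -/
def IsExtractedFrom (S : Finset Plane) (A : Set (Set Plane)) (P : Finset (Finset Plane)) : Prop :=
  ∃ f : Plane → Set Plane, (∀ p ∈ S, f p ∈ A ∧ p ∈ closure (f p)) ∧
    P = S.image (fun p => S.filter (fun q => f q = f p))

/-- `P` is a possible output of bold overlap-greedy on the colored point set `S`. -/
def BoldOverlapGreedyReturns {k : ℕ} (S : Finset Plane) (color : Plane → Fin k)
    (P : Finset (Finset Plane)) : Prop :=
  ∃ L : List (Finset Plane), OverlapGreedyReturns S color L ∧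
    IsExtractedFrom S (boldArrangement L) P

end IslandPartition

/-! Write `r` for the optimum and `m` for the number of greedy islands. Overlap-greedy is greedy set
cover: some island of an optimal partition contains a `1/r` fraction of the uncovered points, so `m
≤ r log n + 1`. The rest is to show that the bold arrangement has `O(r m²)` faces and that
extraction from it yields an island partition.

By the tie-break, the hull of a new island is spanned by its newly covered points `N`
(`IsGreedyChoice.hull_diff`). These lie in no earlier hull, whereas every face lies in one, so no
point of `N` is in a face. A convex face is thus only cut by edges that pass right through it, and a
piece left outside the new hull is the face itself or a half-plane cap of it
(`connectedComponentIn_diff_hull`). Faces stay convex, and the extra pieces number at most the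
incidences between edges of the new hull and old faces. A segment meets at most twice as many faces
as island hulls, so it suffices to bound, for one earlier island `A`, the edges of the new hull that
meet the hull of `A`.

Here greediness enters again: adding a point of `N` to `A` captures a point of another color, since
otherwise `A` would not have been a best choice. Between consecutive upper edges that meet the hull
of `A`, a vertex of `N` sticks out of it; the foreign points captured there alternate from left to
right with extreme points of `A`. Islands of a partition do not cross, so each island can account
for only a bounded part of the alternation (`alternation_le`). Hence at most `2 r + 1` upper edges,
and as many lower ones, meet the hull of `A` (`card_upperEdges_meeting_le`).

Extraction is correct because a line weakly separates two disjoint convex faces, and by general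
position it contains at most two points of `S` (`GeneralPosition.disjoint_hull`). -/

namespace IslandPartition

/-! ### Convex sets: relative interiors, separation, extreme faces -/

section ConvexGeneral

variable {E : Type*} [NormedAddCommGroup E] [NormedSpace ℝ E]

-- A homothety with center `b` and ratio `t` in `(0, 1]` is an open map of the affine span and maps
-- `s` into itself.
open Set Topology in
theorem combo_mem_intrinsicInterior {s : Set E} (hs : Convex ℝ s) {a b : E}
    (ha : a ∈ intrinsicInterior ℝ s) (hb : b ∈ s) {t : ℝ} (ht0 : 0 < t) (ht1 : t ≤ 1) :
    t • (a - b) + b ∈ intrinsicInterior ℝ s := by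
  rw [mem_intrinsicInterior] at ha ⊢
  obtain ⟨a', ha', rfl⟩ := ha
  let b' : affineSpan ℝ s := ⟨b, subset_affineSpan ℝ s hb⟩
  have : Nonempty (affineSpan ℝ s) := ⟨b'⟩
  refine ⟨AffineMap.homothety b' t a', ?_, by simp [AffineMap.homothety_apply, b']⟩
  have hopen : IsOpen (AffineMap.homothety b' t '' interior ((↑) ⁻¹' s : Set (affineSpan ℝ s))) :=
    AffineMap.homothety_isOpenMap b' t ht0.ne' _ isOpen_interior
  refine interior_maximal ?_ hopen ⟨a', ha', rfl⟩
  rintro _ ⟨c, hc, rfl⟩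
  have hc' : (c : E) ∈ s := by
    have : c ∈ ((↑) ⁻¹' s : Set (affineSpan ℝ s)) := interior_subset hc
    exact this
  have : t • ((c : E) - b) + b ∈ s := by
    have := hs hc' hb ht0.le (sub_nonneg.2 ht1) (by ring)
    convert this using 1
    module
  simpa [AffineMap.homothety_apply, b'] using this

theorem convex_intrinsicInterior {s : Set E} (hs : Convex ℝ s) :
    Convex ℝ (intrinsicInterior ℝ s) := by
  intro a ha b hb u v hu hv huv
  rcases hu.eq_or_lt with rfl | hu
  · have : v = 1 := by linarith
    simpa [this] using hb
  · have := combo_mem_intrinsicInterior hs ha (intrinsicInterior_subset hb) hu (by linarith)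
    convert this using 1
    have : v = 1 - u := by linarith
    subst this
    module

open Filter Topology in
theorem subset_closure_intrinsicInterior [FiniteDimensional ℝ E] {s : Set E} (hs : Convex ℝ s) :
    s ⊆ closure (intrinsicInterior ℝ s) := by
  intro b hb
  obtain ⟨a, ha⟩ := Set.Nonempty.intrinsicInterior hs ⟨b, hb⟩
  have hlim : Tendsto (fun t : ℝ => t • (a - b) + b) (𝓝[>] 0) (𝓝 b) := by
    have h : Continuous (fun t : ℝ => t • (a - b) + b) := by fun_prop
    have := h.tendsto 0
    simp only [zero_smul, zero_add] at this
    exact this.mono_left nhdsWithin_le_nhds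
  refine mem_closure_of_tendsto hlim ?_
  filter_upwards [Ioo_mem_nhdsGT (show (0 : ℝ) < 1 by norm_num)] with t ht
  exact combo_mem_intrinsicInterior hs ha hb ht.1 ht.2.le

open Pointwise in
/-- Two disjoint convex sets in a finite-dimensional space are weakly separated by a nonzero
functional. -/
theorem exists_separating [FiniteDimensional ℝ E] {s t : Set E} (hs : Convex ℝ s)
    (ht : Convex ℝ t) (hsn : s.Nonempty) (htn : t.Nonempty) (hd : Disjoint s t) :
    ∃ f : E →L[ℝ] ℝ, f ≠ 0 ∧ ∃ c, (∀ x ∈ s, f x ≤ c) ∧ ∀ y ∈ t, c ≤ f y := by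
  obtain ⟨f, hf, h⟩ : ∃ f : E →L[ℝ] ℝ, f ≠ 0 ∧ ∀ x ∈ s, ∀ y ∈ t, f x ≤ f y := by
    set K : Set E := s - t with hK
    have hKc : Convex ℝ K := hs.sub ht
    have h0 : (0 : E) ∉ K := by
      rintro ⟨x, hx, y, hy, hxy⟩
      have : x = y := sub_eq_zero.1 hxy
      exact Set.disjoint_left.1 hd hx (this ▸ hy)
    suffices ∃ f : E →L[ℝ] ℝ, f ≠ 0 ∧ ∀ z ∈ K, f z ≤ 0 by
      obtain ⟨f, hf, h⟩ := this
      refine ⟨f, hf, fun x hx y hy => ?_⟩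
      have := h (x - y) ⟨x, hx, y, hy, rfl⟩
      rw [map_sub] at this
      linarith
    -- A convex set with empty interior lies in a proper affine subspace, so a nonzero functional is
    -- constant on `K`, and its sign is free.
    rcases (interior K).eq_empty_or_nonempty with hint | hint
    · obtain ⟨k, hk⟩ : K.Nonempty := hsn.sub htn
      have hspan : affineSpan ℝ K ≠ ⊤ := fun h => by
        have := hKc.interior_nonempty_iff_affineSpan_eq_top.2 h
        simp [hint] at this
      have hdir : (affineSpan ℝ K).direction < ⊤ := by
        rw [lt_top_iff_ne_top]
        intro h
        exact hspan ((AffineSubspace.direction_eq_top_iff_of_nonempty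
          ⟨k, subset_affineSpan ℝ K hk⟩).1 h)
      obtain ⟨g, hg, hgk⟩ := Submodule.exists_le_ker_of_lt_top _ hdir
      have hconst : ∀ z ∈ K, g z = g k := by
        intro z hz
        have : z - k ∈ (affineSpan ℝ K).direction :=
          AffineSubspace.vsub_mem_direction (subset_affineSpan ℝ K hz) (subset_affineSpan ℝ K hk)
        have := hgk this
        rw [LinearMap.mem_ker, map_sub] at this
        linarith
      have hg' : LinearMap.toContinuousLinearMap g ≠ 0 := by simpa using hg
      rcases le_total (g k) 0 with h | h
      · exact ⟨LinearMap.toContinuousLinearMap g, hg', fun z hz => by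
          simpa [hconst z hz] using h⟩
      · exact ⟨-LinearMap.toContinuousLinearMap g, by simpa using hg, fun z hz => by
          simpa [hconst z hz] using h⟩
    · obtain ⟨f, hf, h⟩ := geometric_hahn_banach_of_nonempty_interior_point (x := 0) hKc
        (by rcases hint with ⟨z, hz⟩; first | exact ⟨z, hz⟩ | exact fun h => h0 (interior_subset h))
        (by first | exact fun h => h0 (interior_subset h) | exact hint)
      exact ⟨f, hf, fun z hz => by simpa using h z hz⟩
  refine ⟨f, hf, sSup (f '' s), fun x hx => ?_, fun y hy => ?_⟩
  · obtain ⟨y, hy⟩ := htn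
    exact le_csSup ⟨f y, by rintro _ ⟨z, hz, rfl⟩; exact h z hz y hy⟩ ⟨x, hx, rfl⟩
  · exact csSup_le (hsn.image f) (by rintro _ ⟨z, hz, rfl⟩; exact h z hz y hy)

/-- The convex hull of a finite set meets the line on which a functional attains its maximum over
the set in the hull of the maximizers. -/
theorem convexHull_inter_max {N : Set E} {f : E →ₗ[ℝ] ℝ} {c : ℝ} (h : ∀ n ∈ N, f n ≤ c) {p : E}
    (hp : p ∈ convexHull ℝ N) (hpc : f p = c) : p ∈ convexHull ℝ {n ∈ N | f n = c} := by
  classical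
  -- The open half-space below level `c` together with the hull of the maximizers is convex and
  -- contains `N`.
  have hconv : Convex ℝ ({z | f z < c} ∪ convexHull ℝ {n ∈ N | f n = c}) := by
    have hle : ∀ z ∈ convexHull ℝ {n ∈ N | f n = c}, f z = c := by
      have : Convex ℝ {z | f z = c} := convex_hyperplane f.isLinear c
      intro z hz
      exact convexHull_min (fun n hn => hn.2) this hz
    rintro x hx y hy a b ha hb hab
    rcases ha.eq_or_lt with rfl | ha
    · have : b = 1 := by linarith
      simpa [this] using hy
    rcases hb.eq_or_lt with rfl | hb
    · have : a = 1 := by linarith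
      simpa [this] using hx
    have hc : c = a * c + b * c := by rw [← add_mul, hab, one_mul]
    rcases hx with hx | hx
    · left
      have hx' : f x < c := hx
      have hy' : f y ≤ c := by
        rcases hy with hy | hy
        · exact le_of_lt hy
        · exact (hle y hy).le
      simp only [Set.mem_ofPred_eq, map_add, map_smul, smul_eq_mul]
      nlinarith
    · rcases hy with hy | hy
      · left
        have hx' : f x = c := hle x hx
        have hy' : f y < c := hy
        simp only [Set.mem_ofPred_eq, map_add, map_smul, smul_eq_mul]
        nlinarith
      · right
        exact convex_convexHull ℝ _ hx hy ha.le hb.le hab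
  have hsub : convexHull ℝ N ⊆ {z | f z < c} ∪ convexHull ℝ {n ∈ N | f n = c} := by
    refine convexHull_min (fun n hn => ?_) hconv
    rcases (h n hn).lt_or_eq with h1 | h1
    · exact Or.inl h1
    · exact Or.inr (subset_convexHull ℝ _ ⟨hn, h1⟩)
  rcases hsub hp with h1 | h1
  · have h1' : f p < c := h1
    linarith
  · exact h1

theorem map_le_of_mem_convexHull {N : Set E} {f : E →ₗ[ℝ] ℝ} {c : ℝ} (h : ∀ n ∈ N, f n ≤ c) {p : E}
    (hp : p ∈ convexHull ℝ N) : f p ≤ c :=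
  convexHull_min h (convex_halfSpace_le f.isLinear c) hp

theorem exists_le_of_mem_convexHull {N : Set E} {f : E →ₗ[ℝ] ℝ} {p : E}
    (hp : p ∈ convexHull ℝ N) : ∃ n ∈ N, f p ≤ f n := by
  by_contra! h
  have h1 : convexHull ℝ N ⊆ {z | f z < f p} :=
    convexHull_min h (convex_halfSpace_lt f.isLinear (f p))
  have h2 : f p < f p := h1 hp
  exact lt_irrefl _ h2

end ConvexGeneral

/-! ### Polygons in the plane and how they cut convex faces -/

theorem isCompact_hull (N : Finset Plane) : IsCompact (hull N) :=
  N.finite_toSet.isCompact_convexHull ℝ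

theorem isClosed_hull (N : Finset Plane) : IsClosed (hull N) := (isCompact_hull N).isClosed

theorem convex_hull (N : Finset Plane) : Convex ℝ (hull N) := convex_convexHull ℝ _

theorem mem_hull_of_mem {N : Finset Plane} {p : Plane} (hp : p ∈ N) : p ∈ hull N :=
  subset_convexHull ℝ _ (Finset.mem_coe.2 hp)

/-- If a ray leaves the hull of `N` at a point `p` that is not in `N`, then `p` lies on an edge
of the hull, and the ray leaves to the outer side of that edge. -/
theorem exists_edge (N : Finset Plane) {p d : Plane} (hp : p ∈ hull N) (hpN : p ∉ N)
    (hx : ∀ ε : ℝ, 0 < ε → p + ε • d ∉ hull N) :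
    ∃ f : Plane →ₗ[ℝ] ℝ, ∃ u ∈ N, ∃ v ∈ N, f u = f p ∧ f v = f p ∧
      p ∈ segment ℝ u v ∧ (∀ n ∈ N, f n ≤ f p) ∧ 0 < f d := by
  classical
  have hd : d ≠ 0 := fun h => hx 1 one_pos (by simpa [h] using hp)
  let pr : Fin 2 → (Plane →ₗ[ℝ] ℝ) := fun i => (EuclideanSpace.proj (𝕜 := ℝ) i).toLinearMap
  -- Up to scale, `η` measures the position along the ray and `ξ` the position across it.
  obtain ⟨ξ, hξ⟩ : ∃ ξ : Plane →ₗ[ℝ] ℝ, ∀ z, ξ z = d 0 * z 1 - d 1 * z 0 :=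
    ⟨d 0 • pr 1 - d 1 • pr 0, fun z => by simp [pr]⟩
  obtain ⟨η, hη⟩ : ∃ η : Plane →ₗ[ℝ] ℝ, ∀ z, η z = d 0 * z 0 + d 1 * z 1 :=
    ⟨d 0 • pr 0 + d 1 • pr 1, fun z => by simp [pr]⟩
  have hξd : ξ d = 0 := by rw [hξ]; ring
  have hηd : 0 < η d := by
    rw [hη]
    by_contra! h
    apply hd
    ext i
    fin_cases i
    · simp; nlinarith [mul_self_nonneg (d 0), mul_self_nonneg (d 1)]
    · simp; nlinarith [mul_self_nonneg (d 0), mul_self_nonneg (d 1)]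
  have key0 : ∀ z, ξ z = 0 → z = (η z / η d) • d := by
    intro z hz
    have h1 : η d • z = η z • d := by
      rw [hξ] at hz
      ext i
      fin_cases i
      · simp only [hη, PiLp.smul_apply, smul_eq_mul, Fin.zero_eta]
        linear_combination (-d 1) * hz
      · simp only [hη, PiLp.smul_apply, smul_eq_mul, Fin.mk_one]
        linear_combination (d 0) * hz
    rw [div_eq_inv_mul, mul_smul, ← h1, inv_smul_smul₀ hηd.ne']
  have key1 : ∀ q ∈ hull N, ξ q = ξ p → η q ≤ η p := by
    intro q hq hqp
    by_contra! h
    have h1 := key0 (q - p) (by rw [map_sub, hqp, sub_self])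
    rw [map_sub] at h1
    refine hx ((η q - η p) / η d) (div_pos (sub_pos.2 h) hηd) ?_
    rw [← h1]
    simpa using hq
  have hmid : ∀ n ∈ N, ∀ m ∈ N, ξ p < ξ n → ξ m < ξ p →
      ∃ q ∈ segment ℝ m n, ξ q = ξ p ∧
        (ξ n - ξ m) * (η q - η p) = (ξ n - ξ p) * (η m - η p) - (ξ m - ξ p) * (η n - η p) := by
    intro n hn m hm h1 h2
    have h3 : 0 < ξ n - ξ m := by linarith
    refine ⟨((ξ n - ξ p) / (ξ n - ξ m)) • m + ((ξ p - ξ m) / (ξ n - ξ m)) • n,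
      ⟨_, _, div_nonneg (by linarith) h3.le, div_nonneg (by linarith) h3.le, ?_, rfl⟩, ?_, ?_⟩
    · rw [← add_div, div_eq_one_iff_eq h3.ne']; ring
    · simp only [map_add, map_smul, smul_eq_mul]; field_simp; ring
    · simp only [map_add, map_smul, smul_eq_mul]; field_simp; ring
  -- A segment between points on both sides crosses the line of the ray at or before `p`. So, seen
  -- from `p`, slopes on the right are at most those on the left.
  have hpair : ∀ n ∈ N, ∀ m ∈ N, ξ p < ξ n → ξ m < ξ p →
      (η n - η p) / (ξ n - ξ p) ≤ (η m - η p) / (ξ m - ξ p) := by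
    intro n hn m hm h1 h2
    obtain ⟨q, hq, hq1, hq2⟩ := hmid n hn m hm h1 h2
    have hqN : q ∈ hull N :=
      (convex_hull N).segment_subset (mem_hull_of_mem hm) (mem_hull_of_mem hn) hq
    have h3 := key1 q hqN hq1
    rw [← neg_div_neg_eq (η m - η p), div_le_div_iff₀ (by linarith) (by linarith)]
    nlinarith
  obtain ⟨v, hv, u, hu, hvp, hup, huv⟩ : ∃ v ∈ N, ∃ u ∈ N, ξ p < ξ v ∧ ξ u < ξ p ∧
      (η u - η p) / (ξ u - ξ p) ≤ (η v - η p) / (ξ v - ξ p) := by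
    -- If all right slopes were strictly below all left slopes, a slope `β` strictly between would
    -- make `η - β • ξ` larger at `p` than on all of `N`, although `p` is in the hull.
    by_contra! hcon
    obtain ⟨β, hlo, hhi⟩ := Order.exists_between_finsets
      ((N.filter (fun n => ξ p < ξ n)).image (fun n => (η n - η p) / (ξ n - ξ p)))
      ((N.filter (fun n => ξ n < ξ p)).image (fun n => (η n - η p) / (ξ n - ξ p))) (by
        intro a ha b hb
        simp only [Finset.mem_image, Finset.mem_filter] at ha hb
        obtain ⟨n, ⟨hn, hn'⟩, rfl⟩ := ha
        obtain ⟨m, ⟨hm, hm'⟩, rfl⟩ := hb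
        exact hcon n hn m hm hn' hm')
    obtain ⟨n, hn, hle⟩ := exists_le_of_mem_convexHull (f := η - β • ξ) hp
    have hn : n ∈ N := hn
    simp only [LinearMap.sub_apply, LinearMap.smul_apply, smul_eq_mul] at hle
    rcases lt_trichotomy (ξ n) (ξ p) with h | h | h
    · have := hhi _ (Finset.mem_image.2 ⟨n, Finset.mem_filter.2 ⟨hn, h⟩, rfl⟩)
      rw [← neg_div_neg_eq, lt_div_iff₀ (by linarith)] at this
      linarith
    · have h1 := key1 n (mem_hull_of_mem hn) h
      have h2 : η n = η p := by rw [h] at hle; linarith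
      have h3 := key0 (n - p) (by rw [map_sub, h, sub_self])
      rw [map_sub, h2, sub_self, zero_div, zero_smul, sub_eq_zero] at h3
      exact hpN (h3 ▸ hn)
    · have := hlo _ (Finset.mem_image.2 ⟨n, Finset.mem_filter.2 ⟨hn, h⟩, rfl⟩)
      rw [div_lt_iff₀ (by linarith)] at this
      linarith
  set β := (η u - η p) / (ξ u - ξ p) with hβ
  have hβv : (η v - η p) / (ξ v - ξ p) = β := le_antisymm (hpair v hv u hu hvp hup) huv
  have hu0 : η u - η p = β * (ξ u - ξ p) := by
    rw [hβ, div_mul_cancel₀]; linarith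
  have hv0 : η v - η p = β * (ξ v - ξ p) := by
    rw [← hβv, div_mul_cancel₀]; linarith
  refine ⟨η - β • ξ, u, hu, v, hv, ?_, ?_, ?_, ?_, ?_⟩
  · simp only [LinearMap.sub_apply, LinearMap.smul_apply, smul_eq_mul]; linarith
  · simp only [LinearMap.sub_apply, LinearMap.smul_apply, smul_eq_mul]; linarith
  · obtain ⟨q, hq, hq1, hq2⟩ := hmid v hv u hu hvp hup
    have h0 : (ξ v - ξ u) * (η q - η p) = 0 := by rw [hq2, hu0, hv0]; ring
    have h1 : η q - η p = 0 := by
      rcases mul_eq_zero.1 h0 with h | h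
      · linarith
      · exact h
    have h3 := key0 (q - p) (by rw [map_sub, hq1, sub_self])
    rw [map_sub, h1, zero_div, zero_smul, sub_eq_zero] at h3
    exact h3 ▸ hq
  · intro n hn
    simp only [LinearMap.sub_apply, LinearMap.smul_apply, smul_eq_mul]
    rcases lt_trichotomy (ξ n) (ξ p) with h | h | h
    · have := hpair v hv n hn hvp h
      rw [hβv, ← neg_div_neg_eq, le_div_iff₀ (by linarith)] at this
      linarith
    · have h1 := key1 n (mem_hull_of_mem hn) h
      rw [h]; linarith
    · have := hpair n hn u hu h hup
      rw [← hβ, div_le_iff₀ (by linarith)] at this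
      linarith
  · simp only [LinearMap.sub_apply, LinearMap.smul_apply, smul_eq_mul, hξd]
    linarith

theorem finrank_ker_eq_one {f : Plane →ₗ[ℝ] ℝ} (hf : f ≠ 0) :
    Module.finrank ℝ (LinearMap.ker f) = 1 := by
  have h3 := LinearMap.finrank_range_add_finrank_ker f
  have h4 : Module.finrank ℝ (LinearMap.range f) = 1 := by
    rw [LinearMap.range_eq_top.2 (LinearMap.surjective hf)]
    simp
  rw [h4, finrank_euclideanSpace_fin] at h3
  omega

theorem exists_smul_eq_of_map_eq {f : Plane →ₗ[ℝ] ℝ} (hf : f ≠ 0) {u v p z : Plane}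
    (huv : u ≠ v) (h : f u = f v) (h' : f z = f p) : ∃ s : ℝ, z = p + s • (v - u) := by
  have h1 : v - u ∈ LinearMap.ker f := by simp [h]
  have h2 : z - p ∈ LinearMap.ker f := by simp [h']
  obtain ⟨s, hs⟩ := (finrank_eq_one_iff_of_nonzero' (⟨v - u, h1⟩ : LinearMap.ker f)
    (fun h0 => huv (sub_eq_zero.1 (congrArg Subtype.val h0)).symm)).1 (finrank_ker_eq_one hf)
      ⟨z - p, h2⟩
  have hs' : s • (v - u) = z - p := congrArg Subtype.val hs
  exact ⟨s, by rw [hs']; abel⟩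

/-- No three points of `S` lie on a level line of a functional, unless the line contains only two
points of `S`. -/
theorem GeneralPosition.eq_or_eq {S : Finset Plane} (hS : GeneralPosition S)
    {f : Plane →ₗ[ℝ] ℝ} (hf : f ≠ 0) {u v w : Plane} (hu : u ∈ S) (hv : v ∈ S) (hw : w ∈ S)
    (huv : u ≠ v) (h1 : f u = f v) (h2 : f w = f v) : w = u ∨ w = v := by
  classical
  by_contra! h
  refine hS {u, v, w} ?_ (Finset.card_eq_three.2 ⟨u, v, w, huv, h.1.symm, h.2.symm, rfl⟩) ?_
  · intro z hz
    simp only [Finset.mem_insert, Finset.mem_singleton] at hz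
    rcases hz with rfl | rfl | rfl <;> assumption
  · have hker := finrank_ker_eq_one hf
    have hsub : vectorSpan ℝ ((({u, v, w} : Finset Plane)) : Set Plane) ≤ LinearMap.ker f := by
      rw [vectorSpan_def, Submodule.span_le]
      rintro _ ⟨a, ha, b, hb, rfl⟩
      have hval : ∀ z ∈ ((({u, v, w} : Finset Plane)) : Set Plane), f z = f v := by
        intro z hz
        simp only [Finset.coe_insert, Finset.coe_singleton, Set.mem_insert_iff,
          Set.mem_singleton_iff] at hz
        rcases hz with rfl | rfl | rfl
        · exact h1
        · rfl
        · exact h2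
      simp [hval a ha, hval b hb]
    rw [collinear_iff_finrank_le_one]
    exact (Submodule.finrank_mono hsub).trans hker.le

/-- The components of a convex set minus a convex polygon without vertices in it are either the
whole set, or cut off by edges of the polygon. -/
theorem connectedComponentIn_diff_hull {F : Set Plane} (hF : Convex ℝ F) {N : Finset Plane}
    (hNF : ∀ n ∈ N, n ∉ F) {x : Plane} (hx : x ∈ F \ hull N) :
    connectedComponentIn (F \ hull N) x = F ∨
    ∃ f : Plane →ₗ[ℝ] ℝ, ∃ u ∈ N, ∃ v ∈ N, f u = f v ∧ u ≠ v ∧ (∀ n ∈ N, f n ≤ f u) ∧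
      (F ∩ segment ℝ u v).Nonempty ∧ f u < f x ∧
      connectedComponentIn (F \ hull N) x = {z ∈ F | f u < f z} := by
  by_cases hdis : (F ∩ hull N).Nonempty
  · right
    obtain ⟨b, hbF, hbN⟩ := hdis
    -- the last point of the segment from `b` to `x` in the hull
    let T : Set ℝ := Set.Icc 0 1 ∩ (fun t : ℝ => b + t • (x - b)) ⁻¹' hull N
    have hTc : IsCompact T :=
      isCompact_Icc.inter_right ((isClosed_hull N).preimage (by fun_prop))
    have hTn : T.Nonempty := ⟨0, ⟨le_rfl, zero_le_one⟩, by simpa using hbN⟩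
    obtain ⟨t, htT, htmax⟩ := hTc.exists_isGreatest hTn
    have ht1 : t < 1 := by
      refine lt_of_le_of_ne htT.1.2 fun h => hx.2 ?_
      have : b + t • (x - b) ∈ hull N := htT.2
      simpa [h] using this
    set p := b + t • (x - b) with hp
    have hpN : p ∈ hull N := htT.2
    have hpF : p ∈ F := hF.add_smul_sub_mem hbF hx.1 htT.1
    have hout : ∀ ε : ℝ, 0 < ε → p + ε • (x - b) ∉ hull N := by
      intro ε hε hmem
      have hδ : 0 < min ε (1 - t) := lt_min hε (by linarith)
      have h1 : p + min ε (1 - t) • (x - b) ∈ hull N := by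
        have h2 := (convex_hull N).add_smul_sub_mem hpN hmem
          (t := min ε (1 - t) / ε) ⟨by positivity, (div_le_one hε).2 (min_le_left _ _)⟩
        rwa [add_sub_cancel_left, smul_smul, div_mul_cancel₀ _ hε.ne'] at h2
      have h3 : t + min ε (1 - t) ∈ T := by
        refine ⟨⟨by linarith [htT.1.1], by linarith [min_le_right ε (1 - t)]⟩, ?_⟩
        show b + (t + min ε (1 - t)) • (x - b) ∈ hull N
        rw [add_smul, ← add_assoc]
        exact h1
      have := htmax h3
      linarith
    obtain ⟨f, u, hu, v, hv, hfu, hfv, hpuv, hle, hfd⟩ :=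
      exists_edge N hpN (fun h => hNF p h hpF) hout
    have huv : u ≠ v := by
      rintro rfl
      rw [segment_same] at hpuv
      exact hNF u hu (by rw [← Set.mem_singleton_iff.1 hpuv]; exact hpF)
    have hfx : f u < f x := by
      have : f x = f p + (1 - t) * f (x - b) := by
        rw [hp]; simp only [map_add, map_smul, map_sub, smul_eq_mul]; ring
      rw [this, hfu]
      have := mul_pos (sub_pos.2 ht1) hfd
      linarith
    refine ⟨f, u, hu, v, hv, hfu.trans hfv.symm, huv, fun n hn => hfu ▸ hle n hn,
      ⟨p, hpF, hpuv⟩, hfx, ?_⟩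
    have hBle : ∀ z ∈ hull N, f z ≤ f u := fun z hz =>
      map_le_of_mem_convexHull (fun n hn => hfu ▸ hle n hn) hz
    have hsub : {z ∈ F | f u < f z} ⊆ F \ hull N := fun z hz =>
      ⟨hz.1, fun h => absurd (hBle z h) (not_le.2 hz.2)⟩
    -- A point of `F` on the line, beyond `u` or `v`, would by convexity put that vertex into `F`,
    -- as `p` lies between `u` and `v`. So `F` meets the line only inside the hull, and the
    -- component of `x` cannot cross it.
    have hline : ∀ z ∈ F, f z = f u → z ∈ hull N := by
      intro z hz hfz
      have hf0 : f ≠ 0 := by rintro rfl; simp at hfx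
      obtain ⟨s, hs⟩ := exists_smul_eq_of_map_eq hf0 huv (hfu.trans hfv.symm) (hfz.trans hfu)
      obtain ⟨τ, hτ, hpτ⟩ : ∃ τ ∈ Set.Icc (0 : ℝ) 1, u + τ • (v - u) = p := by
        rw [segment_eq_image'] at hpuv
        exact hpuv
      have hz' : z = u + (τ + s) • (v - u) := by rw [hs, ← hpτ]; module
      have hbet : ∀ c : ℝ, 0 < c * s → c * s ≤ s * s → p + c • (v - u) ∈ F := by
        intro c hc hcs
        have hs0 : s ≠ 0 := by rintro rfl; simp at hc
        have h1 := hF.add_smul_sub_mem hpF hz (t := c / s) ⟨by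
          rw [← mul_div_mul_right c s hs0]; exact div_nonneg hc.le (mul_self_nonneg s), by
          rw [← mul_div_mul_right c s hs0]
          exact (div_le_one (lt_of_lt_of_le hc hcs)).2 hcs⟩
        rwa [hs, add_sub_cancel_left, smul_smul, div_mul_cancel₀ _ hs0] at h1
      have h0 : 0 ≤ τ + s := by
        by_contra! h
        refine hNF u hu ?_
        have hτ0 : 0 < τ := lt_of_le_of_ne hτ.1 (by
          rintro rfl
          exact hNF u hu (by rw [zero_smul, add_zero] at hpτ; exact hpτ ▸ hpF))
        have := hbet (-τ) (by nlinarith) (by nlinarith)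
        rw [← hpτ] at this
        convert this using 1
        module
      have h1 : τ + s ≤ 1 := by
        by_contra! h
        refine hNF v hv ?_
        have hτ1 : τ < 1 := lt_of_le_of_ne hτ.2 (by
          rintro rfl
          exact hNF v hv (by rw [one_smul, add_sub_cancel] at hpτ; exact hpτ ▸ hpF))
        have := hbet (1 - τ) (by nlinarith) (by nlinarith)
        rw [← hpτ] at this
        convert this using 1
        module
      rw [hz']
      exact (convex_hull N).add_smul_sub_mem (mem_hull_of_mem hu) (mem_hull_of_mem hv) ⟨h0, h1⟩
    apply Set.Subset.antisymm
    · have hc : IsPreconnected (connectedComponentIn (F \ hull N) x) :=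
        isPreconnected_connectedComponentIn
      have hfc : Continuous f := f.continuous_of_finiteDimensional
      have := hc.subset_left_of_subset_union (u := {z | f u < f z}) (v := {z | f z < f u})
        (isOpen_lt continuous_const hfc) (isOpen_lt hfc continuous_const)
        (Set.disjoint_left.2 fun z (h1 : f u < f z) (h2 : f z < f u) => lt_asymm h1 h2)
        (fun z hz => by
          have hz' := connectedComponentIn_subset _ _ hz
          rcases lt_trichotomy (f u) (f z) with h | h | h
          · exact Or.inl h
          · exact absurd (hline z hz'.1 h.symm) hz'.2
          · exact Or.inr h)
        ⟨x, mem_connectedComponentIn hx, hfx⟩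
      exact fun z hz => ⟨(connectedComponentIn_subset _ _ hz).1, this hz⟩
    · refine IsPreconnected.subset_connectedComponentIn ?_ ⟨hx.1, hfx⟩ hsub
      exact (hF.inter (convex_halfSpace_gt f.isLinear (f u))).isPreconnected
  · left
    have hF' : F \ hull N = F := by
      ext z
      exact ⟨fun h => h.1, fun h => ⟨h, fun h' => hdis ⟨z, h, h'⟩⟩⟩
    rw [hF'] at hx ⊢
    exact hF.isPreconnected.connectedComponentIn hx

/-! ### Coordinates and points above chords -/

/-- `X` and `Y` are linear coordinates of the plane. -/
structure Coords (X Y : Plane →ₗ[ℝ] ℝ) : Prop where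
  ext : ∀ z w, X z = X w → Y z = Y w → z = w
  dual : ∀ f : Plane →ₗ[ℝ] ℝ, ∃ c d : ℝ, f = c • X + d • Y
  up : ∃ z, X z = 0 ∧ Y z = 1

theorem Coords.neg {X Y : Plane →ₗ[ℝ] ℝ} (h : Coords X Y) : Coords X (-Y) where
  ext z w h1 h2 := h.ext z w h1 (by simpa using h2)
  dual f := by
    obtain ⟨c, d, rfl⟩ := h.dual f
    exact ⟨c, -d, by simp⟩
  up := by
    obtain ⟨z, h1, h2⟩ := h.up
    exact ⟨-z, by simp [h1], by simp [h2]⟩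

theorem Coords.sub_smul_ne_zero {X Y : Plane →ₗ[ℝ] ℝ} (h : Coords X Y) (s : ℝ) :
    Y - s • X ≠ 0 := by
  obtain ⟨z, h1, h2⟩ := h.up
  intro h0
  have := LinearMap.congr_fun h0 z
  simp [h1, h2] at this

/-- A shear whose parameter avoids finitely many values separates the points of `S` horizontally.
Then no edge is vertical, and each is an upper or a lower one. -/
theorem exists_coords (S : Finset Plane) :
    ∃ X Y : Plane →ₗ[ℝ] ℝ, Coords X Y ∧ Set.InjOn X S := by
  classical
  let pr : Fin 2 → (Plane →ₗ[ℝ] ℝ) := fun i => (EuclideanSpace.proj (𝕜 := ℝ) i).toLinearMap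
  obtain ⟨t, ht⟩ := Infinite.exists_notMem_finset
    ((S ×ˢ S).image (fun e : Plane × Plane => -(e.1 0 - e.2 0) / (e.1 1 - e.2 1)))
  obtain ⟨X, hX⟩ : ∃ X : Plane →ₗ[ℝ] ℝ, ∀ z, X z = z 0 + t * z 1 :=
    ⟨pr 0 + t • pr 1, fun z => by simp [pr]⟩
  obtain ⟨Y, hY⟩ : ∃ Y : Plane →ₗ[ℝ] ℝ, ∀ z, Y z = z 1 := ⟨pr 1, fun z => by simp [pr]⟩
  have hext : ∀ z w, X z = X w → Y z = Y w → z = w := by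
    intro z w h1 h2
    rw [hX, hX] at h1
    rw [hY, hY] at h2
    ext i
    fin_cases i
    · simp only [Fin.zero_eta]; rw [h2] at h1; linarith
    · exact h2
  refine ⟨X, Y, ⟨hext, fun f => ?_, ⟨!₂[-t, 1], by simp [hX], by simp [hY]⟩⟩, ?_⟩
  · refine ⟨f !₂[1, 0], f !₂[-t, 1], ?_⟩
    ext z
    have : z = X z • !₂[(1 : ℝ), 0] + Y z • !₂[-t, 1] :=
      hext _ _ (by simp [hX, hY]; ring) (by simp [hY])
    conv_lhs => rw [this]
    simp only [map_add, map_smul, smul_eq_mul, LinearMap.add_apply, LinearMap.smul_apply]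
    ring
  · intro p hp q hq hpq
    rw [hX, hX] at hpq
    by_cases h1 : p 1 = q 1
    · refine hext p q ?_ (by rw [hY, hY, h1])
      rw [hX, hX, hpq]
    · refine absurd (Finset.mem_image.2 ⟨(p, q), Finset.mem_product.2 ⟨hp, hq⟩, ?_⟩) ht
      have : p 1 - q 1 ≠ 0 := sub_ne_zero.2 h1
      simp only
      rw [div_eq_iff this]
      linarith

section Above

variable {X Y : Plane →ₗ[ℝ] ℝ}

/-- The point `p` lies (weakly) above the segment from `a` to `b`. -/
def Above (X Y : Plane →ₗ[ℝ] ℝ) (p a b : Plane) : Prop :=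
  ∃ z ∈ segment ℝ a b, X z = X p ∧ Y z ≤ Y p

/-- Let `P` and `Q` be the chord points below `p₂` and `p₃`. Moving from `P` to `p₃` and from `p₂`
to `Q` at equal parameters keeps the `X` coordinates equal, while the height difference changes
sign. -/
theorem Coords.segments_meet (h : Coords X Y) {p₁ p₂ p₃ p₄ : Plane} (h₂ : Above X Y p₂ p₁ p₃)
    (h₃ : Above X Y p₃ p₂ p₄) : (segment ℝ p₁ p₃ ∩ segment ℝ p₂ p₄).Nonempty := by
  obtain ⟨P, hP, hPX, hPY⟩ := h₂
  obtain ⟨Q, hQ, hQX, hQY⟩ := h₃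
  have hd1 : 0 ≤ Y p₂ - Y P := by linarith
  have hd2 : 0 ≤ Y p₃ - Y Q := by linarith
  rcases (add_nonneg hd1 hd2).eq_or_lt with h0 | h0
  · have : P = p₂ := h.ext _ _ hPX (by linarith)
    exact ⟨p₂, this ▸ hP, left_mem_segment ℝ _ _⟩
  · set D := Y p₂ - Y P + (Y p₃ - Y Q) with hD
    have h1 : 0 ≤ (Y p₂ - Y P) / D := by positivity
    have h2 : 0 ≤ (Y p₃ - Y Q) / D := by positivity
    have h3 : (Y p₃ - Y Q) / D + (Y p₂ - Y P) / D = 1 := by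
      rw [← add_div, div_eq_one_iff_eq h0.ne']; linarith
    refine ⟨((Y p₃ - Y Q) / D) • P + ((Y p₂ - Y P) / D) • p₃,
      (convex_segment _ _) hP (right_mem_segment ℝ _ _) h2 h1 h3, ?_⟩
    have : ((Y p₃ - Y Q) / D) • P + ((Y p₂ - Y P) / D) • p₃ =
        ((Y p₃ - Y Q) / D) • p₂ + ((Y p₂ - Y P) / D) • Q := by
      refine h.ext _ _ ?_ ?_
      · simp only [map_add, map_smul, smul_eq_mul, hPX, hQX]
      · simp only [map_add, map_smul, smul_eq_mul]
        field_simp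
        ring
    rw [this]
    exact (convex_segment _ _) (left_mem_segment ℝ _ _) hQ h2 h1 h3

theorem Above.trans {w a a' a'' : Plane} (h₁ : Above X Y w a a') (h₂ : Above X Y a' a a'') :
    Above X Y w a a'' := by
  obtain ⟨_, ⟨r, q, hr, hq, hrq, rfl⟩, hX, hY⟩ := h₁
  obtain ⟨z, hz, hzX, hzY⟩ := h₂
  refine ⟨r • a + q • z, (convex_segment _ _) (left_mem_segment ℝ _ _) hz hr hq hrq, ?_, ?_⟩
  · rw [← hX]; simp [hzX]
  · refine le_trans ?_ hY
    simp only [map_add, map_smul, smul_eq_mul]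
    have := mul_le_mul_of_nonneg_left hzY hq
    linarith

/-- The chord inherits from its endpoints that it lies on or below the line of slope `s` through
`p`. -/
theorem above_of_support {s : ℝ} {p a b : Plane} (h1 : X a ≤ X p) (h2 : X p ≤ X b)
    (h3 : (Y - s • X) a ≤ (Y - s • X) p) (h4 : (Y - s • X) b ≤ (Y - s • X) p) :
    Above X Y p a b := by
  simp only [LinearMap.sub_apply, LinearMap.smul_apply, smul_eq_mul] at h3 h4
  rcases (h1.trans h2).eq_or_lt with h | h
  · have : X a = X p := by linarith
    refine ⟨a, left_mem_segment ℝ _ _, this, ?_⟩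
    rw [this] at h3
    linarith
  · have hpos : 0 < X b - X a := by linarith
    have e1 : 0 ≤ (X b - X p) / (X b - X a) := div_nonneg (by linarith) hpos.le
    have e2 : 0 ≤ (X p - X a) / (X b - X a) := div_nonneg (by linarith) hpos.le
    have e3 : (X b - X p) / (X b - X a) + (X p - X a) / (X b - X a) = 1 := by
      rw [← add_div, div_eq_one_iff_eq hpos.ne']; ring
    have e4 : (X b - X p) / (X b - X a) * X a + (X p - X a) / (X b - X a) * X b = X p := by
      field_simp; ring
    refine ⟨_, ⟨_, _, e1, e2, e3, rfl⟩, ?_, ?_⟩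
    · simpa only [map_add, map_smul, smul_eq_mul] using e4
    · simp only [map_add, map_smul, smul_eq_mul]
      have h5 := mul_le_mul_of_nonneg_left h3 e1
      have h6 := mul_le_mul_of_nonneg_left h4 e2
      have h7 : ((X b - X p) / (X b - X a) + (X p - X a) / (X b - X a)) * (Y p - s * X p)
        = Y p - s * X p := by rw [e3, one_mul]
      have h8 := congrArg (fun r => s * r) e4
      linarith

/-- Growing `A` by a point `b` above the segment from `a` to `a'` adds, apart from `b`, only points
between `a` and `a'` and above the segment. -/
theorem Coords.between_of_mem_hull_insert (h : Coords X Y) {A : Finset Plane} {a a' b w : Plane}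
    {s s' σ : ℝ} (ha : a ∈ A) (ha' : a' ∈ A)
    (hs : ∀ z ∈ A, (Y - s • X) z ≤ (Y - s • X) a) (hsb : (Y - s • X) b ≤ (Y - s • X) a)
    (hs' : ∀ z ∈ A, (Y - s' • X) z ≤ (Y - s' • X) a')
    (hsb' : (Y - s' • X) b ≤ (Y - s' • X) a')
    (hab : X a < X b) (hba' : X b < X a') (hσ : (Y - σ • X) a < (Y - σ • X) b)
    (hσ' : (Y - σ • X) a' < (Y - σ • X) b) (hw : w ∈ hull (insert b A)) (hwA : w ∉ hull A) :
    X a < X w ∧ X w < X a' ∧ Above X Y w a a' := by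
  have hws : (Y - s • X) w ≤ (Y - s • X) a := by
    refine map_le_of_mem_convexHull (fun z hz => ?_) hw
    rcases Finset.mem_insert.1 (Finset.mem_coe.1 hz) with rfl | hz
    · exact hsb
    · exact hs z hz
  have hws' : (Y - s' • X) w ≤ (Y - s' • X) a' := by
    refine map_le_of_mem_convexHull (fun z hz => ?_) hw
    rcases Finset.mem_insert.1 (Finset.mem_coe.1 hz) with rfl | hz
    · exact hsb'
    · exact hs' z hz
  obtain ⟨α, hα, hwα⟩ : ∃ α ∈ hull A, w ∈ segment ℝ b α := by
    unfold hull at hw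
    rw [Finset.coe_insert, convexHull_insert ⟨a, Finset.mem_coe.2 ha⟩, convexJoin_singleton_left]
      at hw
    obtain ⟨α, hα, hwα⟩ := Set.mem_iUnion₂.1 hw
    exact ⟨α, hα, hwα⟩
  have hpos : 0 < X a' - X a := by linarith
  set m := (Y a' - Y a) / (X a' - X a) with hm
  have hma : Y a' - Y a = m * (X a' - X a) := by rw [hm, div_mul_cancel₀ _ hpos.ne']
  simp only [LinearMap.sub_apply, LinearMap.smul_apply, smul_eq_mul] at hσ hσ' hsb hsb' hws hws'
  -- `b` is strictly above the chord of slope `m`: otherwise `σ` would be both smaller and larger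
  -- than `m`.
  have hmb : Y a - m * X a < Y b - m * X b := by
    by_contra! hcon
    have h1 : σ < m := by
      have : 0 < (m - σ) * (X b - X a) := by linarith
      have := pos_of_mul_pos_left this (by linarith)
      linarith
    have h2 : m < σ := by
      have : 0 < (σ - m) * (X a' - X b) := by linarith
      have := pos_of_mul_pos_left this (by linarith)
      linarith
    linarith
  have hms : m < s := by
    have : 0 < (s - m) * (X b - X a) := by linarith
    have := pos_of_mul_pos_left this (by linarith)
    linarith
  have hms' : s' < m := by
    have : 0 < (m - s') * (X a' - X b) := by linarith
    have := pos_of_mul_pos_left this (by linarith)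
    linarith
  have hmw : Y a - m * X a < Y w - m * X w := by
    by_contra! hcon
    -- the segment from `w` to `b` meets the segment from `a` to `a'`
    obtain ⟨q, hq, hqm⟩ : ∃ q ∈ segment ℝ w b, Y q - m * X q = Y a - m * X a := by
      have hden : 0 < (Y b - m * X b) - (Y w - m * X w) := by linarith
      refine ⟨(((Y b - m * X b) - (Y a - m * X a)) / ((Y b - m * X b) - (Y w - m * X w))) • w +
        (((Y a - m * X a) - (Y w - m * X w)) / ((Y b - m * X b) - (Y w - m * X w))) • b,
        ⟨_, _, div_nonneg (by linarith) hden.le, div_nonneg (by linarith) hden.le, ?_, rfl⟩, ?_⟩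
      · rw [← add_div, div_eq_one_iff_eq hden.ne']; ring
      · simp only [map_add, map_smul, smul_eq_mul]
        field_simp
        ring
    have hqs : Y q - s * X q ≤ Y a - s * X a := by
      have := (convex_halfSpace_le (Y - s • X).isLinear (Y a - s * X a)).segment_subset
        (x := w) (y := b) (by simpa using hws) (by simpa using hsb) hq
      simpa using this
    have hqs' : Y q - s' * X q ≤ Y a' - s' * X a' := by
      have := (convex_halfSpace_le (Y - s' • X).isLinear (Y a' - s' * X a')).segment_subset
        (x := w) (y := b) (by simpa using hws') (by simpa using hsb') hq
      simpa using this
    have hXq : X a ≤ X q := by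
      have : 0 ≤ (X q - X a) * (s - m) := by linarith
      have := nonneg_of_mul_nonneg_left this (by linarith)
      linarith
    have hXq' : X q ≤ X a' := by
      have : 0 ≤ (X a' - X q) * (m - s') := by linarith
      have := nonneg_of_mul_nonneg_left this (by linarith)
      linarith
    have hqaa : q ∈ segment ℝ a a' := by
      obtain ⟨z, hz, hzX, hzY⟩ := above_of_support (X := X) (Y := Y) (s := m) (p := q) hXq hXq'
        (by simp only [LinearMap.sub_apply, LinearMap.smul_apply, smul_eq_mul]; linarith)
        (by simp only [LinearMap.sub_apply, LinearMap.smul_apply, smul_eq_mul]; linarith)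
      have hzm : Y a - m * X a ≤ Y z - m * X z := by
        have := (convex_halfSpace_ge (Y - m • X).isLinear (Y a - m * X a)).segment_subset
          (x := a) (y := a') (by simp) (by
            simp only [Set.mem_ofPred_eq, LinearMap.sub_apply, LinearMap.smul_apply, smul_eq_mul]
            linarith) hz
        simpa using this
      rw [hzX] at hzm
      exact h.ext z q hzX (by linarith) ▸ hz
    have hqA : q ∈ hull A :=
      (convex_hull A).segment_subset (mem_hull_of_mem ha) (mem_hull_of_mem ha') hqaa
    -- The order along the line is `α`, `w`, `q`, `b`, with `α` and `q` in the hull of `A`.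
    refine hwA ((convex_hull A).segment_subset hα hqA ?_)
    have hw1 : Wbtw ℝ α w b := mem_segment_iff_wbtw.1 (segment_symm ℝ b α ▸ hwα)
    have hw2 : Wbtw ℝ w q b := mem_segment_iff_wbtw.1 hq
    exact mem_segment_iff_wbtw.2 (hw1.trans_right_left hw2)
  have h1 : X a < X w := by
    have : 0 < (X w - X a) * (s - m) := by linarith
    have := pos_of_mul_pos_left this (by linarith)
    linarith
  have h2 : X w < X a' := by
    have : 0 < (X a' - X w) * (m - s') := by linarith
    have := pos_of_mul_pos_left this (by linarith)
    linarith
  refine ⟨h1, h2, above_of_support (s := m) h1.le h2.le ?_ ?_⟩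
  · simp only [LinearMap.sub_apply, LinearMap.smul_apply, smul_eq_mul]; linarith
  · simp only [LinearMap.sub_apply, LinearMap.smul_apply, smul_eq_mul]; linarith

end Above

/-! ### Color alternation bounds the upper edges that meet an island -/

/-- A long alternation of points of two kinds along an upper hull forces many islands. -/
theorem alternation_le {k : ℕ} {S : Finset Plane} {color : Plane → Fin k}
    {P : Finset (Finset Plane)} (hP : IsIslandPartition S color P) {X Y : Plane →ₗ[ℝ] ℝ}
    (hXY : Coords X Y) {m : ℕ} (a : Fin (m + 1) → Plane) (w : Fin m → Plane)
    (s : Fin (m + 1) → ℝ) (haS : ∀ i, a i ∈ S) (hwS : ∀ i, w i ∈ S)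
    (ha : ∀ i j, (Y - s i • X) (a j) ≤ (Y - s i • X) (a i))
    (hw : ∀ i j, (Y - s i • X) (w j) ≤ (Y - s i • X) (a i))
    (hX₁ : ∀ i : Fin m, X (a i.castSucc) < X (w i)) (hX₂ : ∀ i : Fin m, X (w i) < X (a i.succ))
    (habove : ∀ i : Fin m, Above X Y (w i) (a i.castSucc) (a i.succ))
    (hcolor : ∀ i j, color (w j) ≠ color (a i)) : m ≤ 2 * P.card := by
  classical
  have hmono : StrictMono (fun i => X (a i)) :=
    Fin.strictMono_iff_lt_succ.2 fun i => (hX₁ i).trans (hX₂ i)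
  choose! β hβP hβ using hP.covers
  -- The segments from `w j` to `w i` and from `a i` to `a l` cross, so their islands coincide,
  -- against the colors.
  have key : ∀ i j : Fin m, ∀ l : Fin (m + 1), j < i → i.castSucc < l →
      β (w j) = β (w i) → β (a l) = β (a i.castSucc) → False := by
    intro i j l hji hil hwβ haβ
    have h1 : j.succ ≤ i.castSucc := by
      rw [Fin.le_def, Fin.val_succ, Fin.val_castSucc]; exact hji
    have h2 : i.succ ≤ l := by
      rw [Fin.le_def, Fin.val_succ]; exact hil
    have hA1 : Above X Y (a i.castSucc) (w j) (w i) :=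
      above_of_support (s := s i.castSucc) ((hX₂ j).le.trans (hmono.monotone h1)) (hX₁ i).le
        (hw _ _) (hw _ _)
    have hA2 : Above X Y (a i.succ) (a i.castSucc) (a l) :=
      above_of_support (s := s i.succ) ((hX₁ i).trans (hX₂ i)).le (hmono.monotone h2)
        (ha _ _) (ha _ _)
    obtain ⟨z, hz1, hz2⟩ := hXY.segments_meet hA1 ((habove i).trans hA2)
    have hzw : z ∈ hull (β (w i)) := (convex_hull _).segment_subset
      (mem_hull_of_mem (hwβ ▸ hβ _ (hwS j))) (mem_hull_of_mem (hβ _ (hwS i))) hz1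
    have hza : z ∈ hull (β (a i.castSucc)) := (convex_hull _).segment_subset
      (mem_hull_of_mem (hβ _ (haS _))) (mem_hull_of_mem (haβ ▸ hβ _ (haS l))) hz2
    by_cases heq : β (w i) = β (a i.castSucc)
    · exact hcolor i.castSucc i ((hP.isIsland _ (hβP _ (hwS i))).monochromatic _ (hβ _ (hwS i)) _
        (heq ▸ hβ _ (haS _)))
    · exact Set.disjoint_left.1 (hP.disjoint_hull _ (hβP _ (hwS i)) _ (hβP _ (haS _)) heq) hzw hza
  -- Charge `i` to the island of `a i` if no later `a l` belongs to it, and otherwise to the island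
  -- of `w i`. Last occurrences are distinct, and `key` makes the second kind injective.
  let Φ : Fin m → Finset Plane ⊕ Finset Plane := fun i =>
    if ∀ l, i.castSucc < l → β (a l) ≠ β (a i.castSucc) then Sum.inl (β (a i.castSucc))
    else Sum.inr (β (w i))
  have hΦ : Function.Injective Φ := by
    intro i j hij
    by_contra hne
    wlog hlt : i < j generalizing i j
    · exact this hij.symm (Ne.symm hne) (lt_of_le_of_ne (not_lt.1 hlt) (Ne.symm hne))
    simp only [Φ] at hij
    split_ifs at hij with h1 h2 h2
    · exact h1 j.castSucc hlt (Sum.inl_injective hij).symm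
    · push Not at h2
      obtain ⟨l, hl, hl'⟩ := h2
      exact key j i l hlt hl (Sum.inr_injective hij) hl'
  have hcard := Finset.card_le_card_of_injOn (s := Finset.univ) (t := P.disjSum P) Φ
    (fun i _ => by
      simp only [Φ]
      split_ifs
      · exact Finset.mem_coe.2 (Finset.inl_mem_disjSum.2 (hβP _ (haS _)))
      · exact Finset.mem_coe.2 (Finset.inr_mem_disjSum.2 (hβP _ (hwS _)))) hΦ.injOn
  rw [Finset.card_disjSum, Finset.card_univ, Fintype.card_fin] at hcard
  omega

/-- The slope of the segment `e` in the coordinates `X`, `Y`. -/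
noncomputable def slopeOf (X Y : Plane →ₗ[ℝ] ℝ) (e : Plane × Plane) : ℝ :=
  (Y e.2 - Y e.1) / (X e.2 - X e.1)

/-- A functional that is constant on the segment `e`, and increasing with `Y`. -/
noncomputable def edgeFun (X Y : Plane →ₗ[ℝ] ℝ) (e : Plane × Plane) : Plane →ₗ[ℝ] ℝ :=
  Y - slopeOf X Y e • X

theorem edgeFun_snd {X Y : Plane →ₗ[ℝ] ℝ} {e : Plane × Plane} (h : X e.1 < X e.2) :
    edgeFun X Y e e.2 = edgeFun X Y e e.1 := by
  have h' : X e.2 - X e.1 ≠ 0 := by linarith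
  simp only [edgeFun, slopeOf, LinearMap.sub_apply, LinearMap.smul_apply, smul_eq_mul]
  field_simp
  ring

open Classical in
/-- The edges of the upper hull of `N`. -/
noncomputable def upperEdges (X Y : Plane →ₗ[ℝ] ℝ) (N : Finset Plane) : Finset (Plane × Plane) :=
  (N ×ˢ N).filter (fun e => X e.1 < X e.2 ∧ ∀ n ∈ N, edgeFun X Y e n ≤ edgeFun X Y e e.1)

theorem mem_upperEdges {X Y : Plane →ₗ[ℝ] ℝ} {N : Finset Plane} {e : Plane × Plane} :
    e ∈ upperEdges X Y N ↔ (e.1 ∈ N ∧ e.2 ∈ N) ∧ X e.1 < X e.2 ∧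
      ∀ n ∈ N, edgeFun X Y e n ≤ edgeFun X Y e e.1 := by
  simp [upperEdges]

theorem edgeFun_eq_of_mem_segment {X Y : Plane →ₗ[ℝ] ℝ} {e : Plane × Plane} (h : X e.1 < X e.2)
    {p : Plane} (hp : p ∈ segment ℝ e.1 e.2) : edgeFun X Y e p = edgeFun X Y e e.1 :=
  (convex_hyperplane (edgeFun X Y e).isLinear (edgeFun X Y e e.1)).segment_subset
    (x := e.1) (y := e.2) rfl (edgeFun_snd h) hp

theorem Coords.mem_segment_bounds {X Y : Plane →ₗ[ℝ] ℝ} (hXY : Coords X Y) {e : Plane × Plane}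
    (h : X e.1 < X e.2) {p : Plane} (hp : p ∈ segment ℝ e.1 e.2) (h1 : p ≠ e.1) (h2 : p ≠ e.2) :
    X e.1 < X p ∧ X p < X e.2 := by
  have hf := edgeFun_eq_of_mem_segment (Y := Y) h hp
  have hf2 := edgeFun_snd (Y := Y) h
  simp only [edgeFun, LinearMap.sub_apply, LinearMap.smul_apply, smul_eq_mul] at hf hf2
  have hge := (convex_halfSpace_ge X.isLinear (X e.1)).segment_subset
    (x := e.1) (y := e.2) (le_refl (X e.1)) h.le hp
  have hle := (convex_halfSpace_le X.isLinear (X e.2)).segment_subset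
    (x := e.1) (y := e.2) h.le (le_refl (X e.2)) hp
  refine ⟨lt_of_le_of_ne hge fun heq => h1 (hXY.ext _ _ heq.symm ?_),
    lt_of_le_of_ne hle fun heq => h2 (hXY.ext _ _ heq ?_)⟩
  · rw [← heq] at hf; linarith
  · rw [heq] at hf; linarith

/-- Edges of equal slope both support `N`, so they lie on one line, which has at most two points of
`S`. -/
theorem upperEdges_slope_injOn {S N : Finset Plane} (hS : GeneralPosition S) (hNS : N ⊆ S)
    {X Y : Plane →ₗ[ℝ] ℝ} (hXY : Coords X Y) :
    Set.InjOn (slopeOf X Y) (upperEdges X Y N) := by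
  rintro ⟨u, v⟩ he ⟨u', v'⟩ he' hs
  obtain ⟨⟨hu, hv⟩, hlt, hle⟩ := mem_upperEdges.1 he
  obtain ⟨⟨hu', hv'⟩, hlt', hle'⟩ := mem_upperEdges.1 he'
  have hfun : edgeFun X Y (u', v') = edgeFun X Y (u, v) := by simp only [edgeFun, hs]
  have h1 := edgeFun_snd (Y := Y) hlt
  have h2 := edgeFun_snd (Y := Y) hlt'
  rw [hfun] at hle' h2
  simp only at hu hv hu' hv' hlt hlt' hle hle' h1 h2
  have h3 := le_antisymm (hle u' hu') (hle' u hu)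
  have hne : edgeFun X Y (u, v) ≠ 0 := hXY.sub_smul_ne_zero _
  have huv : u ≠ v := by rintro rfl; exact lt_irrefl _ hlt
  have e1 := hS.eq_or_eq hne (hNS hu) (hNS hv) (hNS hu') huv h1.symm (h3.trans h1.symm)
  have e2 := hS.eq_or_eq hne (hNS hu) (hNS hv) (hNS hv') huv h1.symm ((h2.trans h3).trans h1.symm)
  rcases e1 with rfl | rfl <;> rcases e2 with rfl | rfl
  · exact absurd hlt' (lt_irrefl _)
  · rfl
  · exact absurd hlt' (lt_asymm hlt)
  · exact absurd hlt' (lt_irrefl _)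

/-- Between two upper edges of `N` that meet the hull of `A`, some direction has its extreme
point in `N` and not in `A`. -/
theorem Coords.exists_slope_between {X Y : Plane →ₗ[ℝ] ℝ} (hXY : Coords X Y) {A N : Finset Plane}
    (hNA : ∀ n ∈ N, n ∉ hull A) {e e' : Plane × Plane} (he : e ∈ upperEdges X Y N)
    (he' : e' ∈ upperEdges X Y N) (hs : slopeOf X Y e' < slopeOf X Y e)
    (hm : (segment ℝ e.1 e.2 ∩ hull A).Nonempty) (hm' : (segment ℝ e'.1 e'.2 ∩ hull A).Nonempty) :
    ∃ σ, slopeOf X Y e' < σ ∧ σ < slopeOf X Y e ∧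
      ∀ a ∈ A, (Y - σ • X) a < (Y - σ • X) e.2 := by
  obtain ⟨⟨hu, hv⟩, hlt, hle⟩ := mem_upperEdges.1 he
  obtain ⟨⟨hu', hv'⟩, hlt', hle'⟩ := mem_upperEdges.1 he'
  obtain ⟨p, hp, hpA⟩ := hm
  obtain ⟨p', hp', hpA'⟩ := hm'
  have hne : ∀ n ∈ N, ∀ q ∈ hull A, q ≠ n := fun n hn q hq h => hNA n hn (h ▸ hq)
  have hb := hXY.mem_segment_bounds hlt hp (hne _ hu _ hpA) (hne _ hv _ hpA)
  have hb' := hXY.mem_segment_bounds hlt' hp' (hne _ hu' _ hpA') (hne _ hv' _ hpA')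
  have hep := edgeFun_eq_of_mem_segment (Y := Y) hlt hp
  have hep' := edgeFun_eq_of_mem_segment (Y := Y) hlt' hp'
  have hev := edgeFun_snd (Y := Y) hlt
  have hp'N : p' ∈ hull N :=
    (convex_hull N).segment_subset (mem_hull_of_mem hu') (mem_hull_of_mem hv') hp'
  have hp's := map_le_of_mem_convexHull (f := edgeFun X Y e) (fun n hn => hle n hn) hp'N
  have hu's := hle _ hu'
  have hvs' := hle' _ hv
  -- Separate the vertex `e.2` from the hull of `A` by `θ = c X + d Y`. It exceeds `p` on its left
  -- and `p'` on its right in `θ`, which forces `d > 0` and `c + d s' < 0 < c + d s`. So `σ = -c /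
  -- d` lies between the slopes.
  obtain ⟨θ, c₀, hθA, hθv⟩ := geometric_hahn_banach_closed_point (convex_hull A) (isClosed_hull A)
    (hNA _ hv)
  obtain ⟨c, d, hcd⟩ := hXY.dual θ.toLinearMap
  have hθ : ∀ z, θ z = c * X z + d * Y z := fun z => by
    have := LinearMap.congr_fun hcd z
    simpa using this
  have h1 : θ p < θ e.2 := (hθA p hpA).trans hθv
  have h2 : θ p' < θ e.2 := (hθA p' hpA').trans hθv
  rw [hθ, hθ] at h1 h2
  simp only [edgeFun, LinearMap.sub_apply, LinearMap.smul_apply, smul_eq_mul] at *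
  set s := slopeOf X Y e
  set s' := slopeOf X Y e'
  have hXv : X e.2 ≤ X e'.1 := by
    have : 0 ≤ (X e'.1 - X e.2) * (s - s') := by linarith
    have := nonneg_of_mul_nonneg_left this (by linarith)
    linarith
  have hXvp : X e.2 < X p' := hXv.trans_lt hb'.1
  have hcs : 0 < c + d * s := by
    have hY : Y e.2 - Y p = s * (X e.2 - X p) := by linarith
    have : 0 < (c + d * s) * (X e.2 - X p) := by
      have : (c + d * s) * (X e.2 - X p) = c * (X e.2 - X p) + d * (s * (X e.2 - X p)) := by ring
      rw [this, ← hY]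
      linarith
    exact pos_of_mul_pos_left this (by linarith)
  have hd : 0 < d := by
    by_contra! hd
    have h3 : s * (X e.2 - X p') ≤ Y e.2 - Y p' := by linarith
    have h4 := mul_le_mul_of_nonpos_left h3 hd
    have h5 : (c + d * s) * (X p' - X e.2) < 0 := by linarith
    have h6 : 0 < (c + d * s) * (X p' - X e.2) := mul_pos hcs (by linarith)
    linarith
  have hcs' : c + d * s' < 0 := by
    have h3 : Y e.2 - Y p' ≤ s' * (X e.2 - X p') := by linarith
    have h4 := mul_le_mul_of_nonneg_left h3 hd.le
    have h5 : 0 < -(c + d * s') * (X p' - X e.2) := by linarith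
    have := pos_of_mul_pos_left h5 (by linarith)
    linarith
  refine ⟨-c / d, ?_, ?_, fun a ha => ?_⟩
  · rw [lt_div_iff₀ hd]; linarith
  · rw [div_lt_iff₀ hd]; linarith
  · have h3 : θ a < θ e.2 := (hθA a (mem_hull_of_mem ha)).trans hθv
    rw [hθ, hθ] at h3
    have h4 : ∀ z, Y z - -c / d * X z = (c * X z + d * Y z) / d := fun z => by
      field_simp; ring
    rw [h4, h4]
    exact div_lt_div_of_pos_right h3 hd

open Classical in
/-- Only few upper edges of `N` meet the hull of the island `A`, if every extension of `A` by a
point of `N` captures a point of a different color. -/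
theorem card_upperEdges_meeting_le {k : ℕ} {S : Finset Plane} {color : Plane → Fin k}
    {P : Finset (Finset Plane)} (hP : IsIslandPartition S color P) (hS : GeneralPosition S)
    {X Y : Plane →ₗ[ℝ] ℝ} (hXY : Coords X Y) {A N : Finset Plane} (hNS : N ⊆ S)
    (hA : IsIsland S color A) (hNA : ∀ n ∈ N, n ∉ hull A)
    (hext : ∀ b ∈ N, ∃ w ∈ S, w ∈ hull (insert b A) ∧ ∀ a ∈ A, color w ≠ color a) :
    ((upperEdges X Y N).filter (fun e => (segment ℝ e.1 e.2 ∩ hull A).Nonempty)).card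
      ≤ 2 * P.card + 1 := by
  set T := (upperEdges X Y N).filter (fun e => (segment ℝ e.1 e.2 ∩ hull A).Nonempty) with hT
  rcases hTc : T.card with _ | m
  · omega
  have hinj : Set.InjOn (fun e => -slopeOf X Y e) T := fun e he e' he' h =>
    upperEdges_slope_injOn hS hNS hXY (Finset.mem_filter.1 he).1 (Finset.mem_filter.1 he').1
      (neg_injective h)
  -- Increasing negated slope lists upper edges from left to right.
  let κ := (T.image (fun e => -slopeOf X Y e)).orderEmbOfFin (k := m + 1)
    (by rw [Finset.card_image_of_injOn hinj, hTc])
  have hκ : ∀ i, ∃ e ∈ T, -slopeOf X Y e = κ i := fun i =>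
    Finset.mem_image.1 (Finset.orderEmbOfFin_mem _ _ i)
  choose e heT heκ using hκ
  have hslope : ∀ i j, i < j → slopeOf X Y (e j) < slopeOf X Y (e i) := by
    intro i j hij
    have h1 := κ.strictMono hij
    rw [← heκ, ← heκ] at h1
    linarith
  have heU : ∀ i, e i ∈ upperEdges X Y N := fun i => (Finset.mem_filter.1 (heT i)).1
  have hem : ∀ i, (segment ℝ (e i).1 (e i).2 ∩ hull A).Nonempty := fun i =>
    (Finset.mem_filter.1 (heT i)).2
  have hAn : A.Nonempty := by
    obtain ⟨p, -, hp⟩ := hem 0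
    exact Finset.coe_nonempty.1 (convexHull_nonempty_iff.1 ⟨p, hp⟩)
  have hmax : ∀ i, ∃ a ∈ A, ∀ z ∈ A, edgeFun X Y (e i) z ≤ edgeFun X Y (e i) a := fun i =>
    Finset.exists_max_image A _ hAn
  choose a haA hamax using hmax
  -- Edge `i` meets the hull of `A`, so the parallel supporting line of `A` is on or above it and
  -- bounds `N` as well.
  have hNmax : ∀ i, ∀ n ∈ N, edgeFun X Y (e i) n ≤ edgeFun X Y (e i) (a i) := by
    intro i n hn
    obtain ⟨-, hlt, hle⟩ := mem_upperEdges.1 (heU i)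
    obtain ⟨p, hp, hpA⟩ := hem i
    refine (hle n hn).trans ?_
    rw [← edgeFun_eq_of_mem_segment hlt hp]
    exact map_le_of_mem_convexHull (fun z hz => hamax i z hz) hpA
  have hvN : ∀ i, (e i).2 ∈ N := fun i => (mem_upperEdges.1 (heU i)).1.2
  -- Between edge `i` and the next one, `A` is extended by the right end of edge `i`.
  choose w hwS hwH hwc using fun i : Fin m => hext (e i.castSucc).2 (hvN _)
  have hall : ∀ i : Fin m, X (a i.castSucc) < X (w i) ∧ X (w i) < X (a i.succ) ∧
      Above X Y (w i) (a i.castSucc) (a i.succ) := by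
    intro i
    obtain ⟨σ, hσ', hσ, hσA⟩ := hXY.exists_slope_between hNA (heU i.castSucc) (heU i.succ)
      (hslope _ _ (Fin.castSucc_lt_succ)) (hem _) (hem _)
    have h1 := hNmax i.castSucc _ (hvN i.castSucc)
    have h2 := hNmax i.succ _ (hvN i.castSucc)
    have h3 := hσA _ (haA i.castSucc)
    have h4 := hσA _ (haA i.succ)
    have h1' := h1
    have h2' := h2
    have h3' := h3
    have h4' := h4
    simp only [edgeFun, LinearMap.sub_apply, LinearMap.smul_apply, smul_eq_mul] at h1' h2' h3' h4'
    refine hXY.between_of_mem_hull_insert (haA _) (haA _) (hamax i.castSucc) h1 (hamax i.succ) h2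
      ?_ ?_ h3 h4 (hwH i) ?_
    · have : 0 < (X (e i.castSucc).2 - X (a i.castSucc)) * (slopeOf X Y (e i.castSucc) - σ) := by
        linarith
      have := pos_of_mul_pos_left this (by linarith)
      linarith
    · have : 0 < (X (a i.succ) - X (e i.castSucc).2) * (σ - slopeOf X Y (e i.succ)) := by
        linarith
      have := pos_of_mul_pos_left this (by linarith)
      linarith
    · intro h
      have : w i ∈ (A : Set Plane) := by rw [← hA.hull_inter]; exact ⟨h, hwS i⟩
      exact hwc i (w i) (Finset.mem_coe.1 this) rfl
  have := alternation_le hP hXY a w (fun i => slopeOf X Y (e i)) (fun i => hA.subset (haA i)) hwS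
    (fun i j => hamax i _ (haA j))
    (fun i j => by
      refine map_le_of_mem_convexHull (f := edgeFun X Y (e i)) (fun z hz => ?_) (hwH j)
      rcases Finset.mem_insert.1 (Finset.mem_coe.1 hz) with rfl | hz
      · exact hNmax i _ (hvN _)
      · exact hamax i z hz)
    (fun i => (hall i).1) (fun i => (hall i).2.1) (fun i => (hall i).2.2)
    (fun i j => hwc j _ (haA i))
  omega

/-! ### Counting faces along segments and after a cut -/

/-- The pieces into which the set `B` cuts the members of `A`. -/
def cut (A : Set (Set Plane)) (B : Set Plane) : Set (Set Plane) :=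
  {G | ∃ F ∈ A, ∃ x ∈ F \ B, G = connectedComponentIn (F \ B) x}

/-- The members of `A` that meet `s`. -/
def meeting (A : Set (Set Plane)) (s : Set Plane) : Set (Set Plane) :=
  {F ∈ A | (F ∩ s).Nonempty}

theorem boldAugment_eq (A : Set (Set Plane)) (I : Finset Plane) :
    boldAugment A I = {intrinsicInterior ℝ (hull I)} ∪ cut A (hull I) := rfl

theorem meeting_subset (A : Set (Set Plane)) (s : Set Plane) : meeting A s ⊆ A :=
  fun _ h => h.1

theorem finite_meeting {A : Set (Set Plane)} (hA : A.Finite) (s : Set Plane) :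
    (meeting A s).Finite := hA.subset (meeting_subset A s)

theorem meeting_union (A A' : Set (Set Plane)) (s : Set Plane) :
    meeting (A ∪ A') s = meeting A s ∪ meeting A' s := by
  ext F
  constructor
  · rintro ⟨h | h, h'⟩
    · exact Or.inl ⟨h, h'⟩
    · exact Or.inr ⟨h, h'⟩
  · rintro (⟨h, h'⟩ | ⟨h, h'⟩)
    · exact ⟨Or.inl h, h'⟩
    · exact ⟨Or.inr h, h'⟩

theorem connectedComponentIn_eq_of_segment {F B : Set Plane} (hF : Convex ℝ F) {z z' : Plane}
    (hz : z ∈ F) (hz' : z' ∈ F) (h : Disjoint (segment ℝ z z') B) :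
    connectedComponentIn (F \ B) z = connectedComponentIn (F \ B) z' := by
  refine connectedComponentIn_eq ?_
  have hsub : segment ℝ z z' ⊆ F \ B := fun y hy =>
    ⟨hF.segment_subset hz hz' hy, Set.disjoint_left.1 h hy⟩
  exact (convex_segment z z').isPreconnected.subset_connectedComponentIn
    (left_mem_segment ℝ _ _) hsub (right_mem_segment ℝ _ _)

/-- Cutting by `B` does not increase the number of faces that meet `s`, if `B` does not separate
points of `s`. -/
theorem ncard_meeting_cut_le {A : Set (Set Plane)} (hA : A.Finite) (hconv : ∀ F ∈ A, Convex ℝ F)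
    {B s : Set Plane} (hs : ∀ z ∈ s \ B, ∀ z' ∈ s \ B, Disjoint (segment ℝ z z') B) :
    (meeting (cut A B) s).Finite ∧ (meeting (cut A B) s).ncard ≤ (meeting A s).ncard := by
  classical
  -- At most one piece of each `F` meets `s`: any two points of `F ∩ s` outside `B` are joined by a
  -- segment in `F \ B`.
  let φ : Set Plane → Set Plane := fun F =>
    if h : ((F ∩ s) \ B).Nonempty then connectedComponentIn (F \ B) h.some else ∅
  have hsub : meeting (cut A B) s ⊆ φ '' meeting A s := by
    rintro _ ⟨⟨F, hF, x, hx, rfl⟩, z, hz, hzs⟩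
    have hzF := connectedComponentIn_subset _ _ hz
    have hne : ((F ∩ s) \ B).Nonempty := ⟨z, ⟨hzF.1, hzs⟩, hzF.2⟩
    refine ⟨F, ⟨hF, z, hzF.1, hzs⟩, ?_⟩
    simp only [φ, dif_pos hne]
    rw [connectedComponentIn_eq hz]
    have hsome := hne.some_mem
    exact connectedComponentIn_eq_of_segment (hconv F hF) hsome.1.1 hzF.1
      (hs _ ⟨hsome.1.2, hsome.2⟩ _ ⟨hzs, hzF.2⟩)
  have hfin := (finite_meeting hA s).image φ
  exact ⟨hfin.subset hsub,
    (Set.ncard_le_ncard hsub hfin).trans (Set.ncard_image_le (finite_meeting hA s))⟩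

/-- On a ray from `q ∈ B`, a convex set occupies an initial interval. -/
theorem disjoint_segment_of_ray {B : Set Plane} (hB : Convex ℝ B) {q u z z' : Plane} (hq : q ∈ B)
    (hz : z ∈ segment ℝ q u) (hz' : z' ∈ segment ℝ q u) (hzB : z ∉ B) (hzB' : z' ∉ B) :
    Disjoint (segment ℝ z z') B := by
  rw [segment_eq_image'] at hz hz'
  obtain ⟨t, ht, rfl⟩ := hz
  obtain ⟨t', ht', rfl⟩ := hz'
  rw [Set.disjoint_left]
  rintro _ ⟨α, β, hα, hβ, hαβ, rfl⟩ hb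
  have hcomb : α • (q + t • (u - q)) + β • (q + t' • (u - q)) = q + (α * t + β * t') • (u - q) := by
    have : α = 1 - β := by linarith
    subst this
    module
  simp only [hcomb] at hb
  have key : ∀ r, 0 ≤ r → r ≤ α * t + β * t' → q + r • (u - q) ∈ B := by
    intro r hr hrle
    rcases (hr.trans hrle).eq_or_lt with h0 | h0
    · have : r = 0 := by linarith
      simpa [this] using hq
    · have := hB.add_smul_sub_mem hq hb (t := r / (α * t + β * t'))
        ⟨div_nonneg hr h0.le, (div_le_one h0).2 hrle⟩
      rwa [add_sub_cancel_left, smul_smul, div_mul_cancel₀ _ h0.ne'] at this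
  rcases le_total t t' with h | h
  · have h1 := mul_le_mul_of_nonneg_left h hβ
    have h2 : α * t + β * t = t := by rw [← add_mul, hαβ, one_mul]
    exact hzB (key t ht.1 (by linarith))
  · have h1 := mul_le_mul_of_nonneg_left h hα
    have h2 : α * t' + β * t' = t' := by rw [← add_mul, hαβ, one_mul]
    exact hzB' (key t' ht'.1 (by linarith))

/-- A bold augmentation creates at most two more faces along a segment, and none if the segment
misses the new hull. -/
theorem ncard_meeting_boldAugment_le {A : Set (Set Plane)} (hA : A.Finite)
    (hconv : ∀ F ∈ A, Convex ℝ F) (hdisj : A.PairwiseDisjoint id) (I : Finset Plane)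
    (u v : Plane) :
    (meeting (boldAugment A I) (segment ℝ u v)).ncard ≤ (meeting A (segment ℝ u v)).ncard + 2 ∧
    (¬ (segment ℝ u v ∩ hull I).Nonempty → (meeting (boldAugment A I) (segment ℝ u v)).ncard ≤
      (meeting A (segment ℝ u v)).ncard) := by
  have hnew : meeting ({intrinsicInterior ℝ (hull I)} : Set (Set Plane)) (segment ℝ u v) ⊆
    {intrinsicInterior ℝ (hull I)} := meeting_subset _ _
  have hempty : ¬ (segment ℝ u v ∩ hull I).Nonempty → (meeting (boldAugment A I)
      (segment ℝ u v)).ncard ≤ (meeting A (segment ℝ u v)).ncard := by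
    intro h
    have h0 : meeting ({intrinsicInterior ℝ (hull I)} : Set (Set Plane)) (segment ℝ u v) = ∅ := by
      rw [Set.eq_empty_iff_forall_notMem]
      rintro F ⟨hF, z, hz, hzs⟩
      rw [Set.mem_singleton_iff] at hF
      subst hF
      exact h ⟨z, hzs, intrinsicInterior_subset hz⟩
    rw [boldAugment_eq, meeting_union, h0, Set.empty_union]
    refine (ncard_meeting_cut_le hA hconv fun z hz z' hz' => ?_).2
    rw [Set.disjoint_left]
    exact fun y hy hyB => h ⟨y, (convex_segment u v).segment_subset hz.1 hz'.1 hy, hyB⟩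
  refine ⟨?_, hempty⟩
  by_cases h : (segment ℝ u v ∩ hull I).Nonempty
  swap
  · exact (hempty h).trans (by omega)
  -- Split at `q`. Cutting does not increase the count on either half. A face meeting both halves
  -- contains `q`, so at most one old face is counted twice; the new hull's own face gives the
  -- second extra unit.
  obtain ⟨q, hq, hqB⟩ := h
  have hquv := mem_segment_iff_wbtw.1 hq
  have hside : ∀ p, (meeting (cut A (hull I)) (segment ℝ q p)).Finite ∧
      (meeting (cut A (hull I)) (segment ℝ q p)).ncard ≤ (meeting A (segment ℝ q p)).ncard :=
    fun p => ncard_meeting_cut_le hA hconv fun z hz z' hz' =>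
      disjoint_segment_of_ray (convex_hull I) hqB hz.1 hz'.1 hz.2 hz'.2
  have hsplit : ∀ z ∈ segment ℝ u v, z ∈ segment ℝ q u ∨ z ∈ segment ℝ q v := by
    intro z hz
    obtain ⟨x, hx, rfl⟩ := (segment_eq_image' ℝ u v) ▸ hq
    obtain ⟨y, hy, rfl⟩ := (segment_eq_image' ℝ u v) ▸ hz
    have hmem : ∀ r ∈ Set.Icc (0 : ℝ) 1, u + r • (v - u) ∈ segment ℝ u v := fun r hr => by
      rw [segment_eq_image']; exact ⟨r, hr, rfl⟩
    rcases le_total y x with h | h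
    · left
      rcases hx.1.eq_or_lt with h0 | h0
      · have h1 : y = 0 := by linarith [hy.1]
        simp only [h1, zero_smul, add_zero]
        exact right_mem_segment ℝ _ _
      · refine ⟨y / x, 1 - y / x, div_nonneg hy.1 h0.le, sub_nonneg.2 ((div_le_one h0).2 h),
          by ring, ?_⟩
        have : y = y / x * x := by field_simp
        conv_rhs => rw [this]
        module
    · right
      rcases hx.2.eq_or_lt with h0 | h0
      · have h1 : y = 1 := by linarith [hy.2]
        simp only [h1, one_smul, add_sub_cancel]
        exact right_mem_segment ℝ _ _
      · have hx1 : 0 < 1 - x := by linarith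
        refine ⟨(1 - y) / (1 - x), (y - x) / (1 - x), div_nonneg (by linarith [hy.2]) hx1.le,
          div_nonneg (by linarith) hx1.le, by field_simp; ring, ?_⟩
        have e1 : (y - x) / (1 - x) = 1 - (1 - y) / (1 - x) := by field_simp; ring
        have e2 : y = 1 - (1 - y) / (1 - x) * (1 - x) := by field_simp; ring
        rw [e1]
        conv_rhs => rw [e2]
        module
  have hsub : meeting (cut A (hull I)) (segment ℝ u v) ⊆
      meeting (cut A (hull I)) (segment ℝ q u) ∪ meeting (cut A (hull I)) (segment ℝ q v) := by
    rintro F ⟨hF, z, hz, hzs⟩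
    rcases hsplit z hzs with h | h
    · exact Or.inl ⟨hF, z, hz, h⟩
    · exact Or.inr ⟨hF, z, hz, h⟩
  have hunion : meeting A (segment ℝ q u) ∪ meeting A (segment ℝ q v) ⊆
      meeting A (segment ℝ u v) := by
    rintro F (⟨hF, z, hz, hzs⟩ | ⟨hF, z, hz, hzs⟩)
    · exact ⟨hF, z, hz, (convex_segment u v).segment_subset hq (left_mem_segment ℝ _ _) hzs⟩
    · exact ⟨hF, z, hz, (convex_segment u v).segment_subset hq (right_mem_segment ℝ _ _) hzs⟩
  have hinter : (meeting A (segment ℝ q u) ∩ meeting A (segment ℝ q v)).ncard ≤ 1 := by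
    rw [Set.ncard_le_one ((finite_meeting hA _).inter_of_left _)]
    have hqF : ∀ F ∈ meeting A (segment ℝ q u) ∩ meeting A (segment ℝ q v), q ∈ F := by
      rintro F ⟨⟨hF, z, hz, hzs⟩, ⟨-, z', hz', hzs'⟩⟩
      have h1 : Wbtw ℝ u z q := mem_segment_iff_wbtw.1 (segment_symm ℝ q u ▸ hzs)
      have h2 : Wbtw ℝ q z' v := mem_segment_iff_wbtw.1 hzs'
      have h3 : Wbtw ℝ z q z' := (hquv.trans_left_right h1).trans_right_left h2
      exact (hconv F hF).segment_subset hz hz' (mem_segment_iff_wbtw.2 h3)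
    intro F hF G hG
    by_contra hne
    exact Set.disjoint_left.1 (hdisj hF.1.1 hG.1.1 hne) (hqF F hF) (hqF G hG)
  have hcount := Set.ncard_union_add_ncard_inter (meeting A (segment ℝ q u))
    (meeting A (segment ℝ q v)) (finite_meeting hA _) (finite_meeting hA _)
  have h1 := Set.ncard_le_ncard hunion (finite_meeting hA _)
  have h2 := Set.ncard_le_ncard hsub ((hside u).1.union (hside v).1)
  have h3 := Set.ncard_union_le (meeting (cut A (hull I)) (segment ℝ q u))
    (meeting (cut A (hull I)) (segment ℝ q v))
  have h4 := (hside u).2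
  have h5 := (hside v).2
  have h6 := Set.ncard_le_ncard hnew
  rw [Set.ncard_singleton] at h6
  rw [boldAugment_eq, meeting_union]
  have h7 := Set.ncard_union_le
    (meeting ({intrinsicInterior ℝ (hull I)} : Set (Set Plane)) (segment ℝ u v))
    (meeting (cut A (hull I)) (segment ℝ u v))
  omega

/-- The part of `F` above the line through `e`. -/
def cap (X Y : Plane →ₗ[ℝ] ℝ) (e : Plane × Plane) (F : Set Plane) : Set Plane :=
  {z ∈ F | edgeFun X Y e e.1 < edgeFun X Y e z}

theorem Coords.exists_cap {X Y : Plane →ₗ[ℝ] ℝ} {N : Finset Plane} {F : Set Plane} {c d : ℝ}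
    (hd : 0 < d) {u v : Plane} (hu : u ∈ N) (hv : v ∈ N)
    (huv : (c • X + d • Y) u = (c • X + d • Y) v)
    (hX : X u < X v) (hle : ∀ n ∈ N, (c • X + d • Y) n ≤ (c • X + d • Y) u) :
    (u, v) ∈ upperEdges X Y N ∧
      {z ∈ F | (c • X + d • Y) u < (c • X + d • Y) z} = cap X Y (u, v) F := by
  have hX' : X v - X u ≠ 0 := by linarith
  have hs : c = -(d * slopeOf X Y (u, v)) := by
    simp only [LinearMap.add_apply, LinearMap.smul_apply, smul_eq_mul] at huv
    simp only [slopeOf]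
    field_simp
    linarith
  have hfun : ∀ z, (c • X + d • Y) z = d * edgeFun X Y (u, v) z := by
    intro z
    simp only [edgeFun, LinearMap.add_apply, LinearMap.smul_apply, LinearMap.sub_apply,
      smul_eq_mul]
    rw [hs]; ring
  refine ⟨mem_upperEdges.2 ⟨⟨hu, hv⟩, hX, fun n hn => ?_⟩, ?_⟩
  · have := hle n hn
    rw [hfun, hfun] at this
    exact le_of_mul_le_mul_left this hd
  · ext z
    simp only [cap, Set.mem_ofPred_eq, hfun, mul_lt_mul_iff_right₀ hd]

/-- Cutting by a polygon without vertices inside the faces only cuts off caps along the edges. -/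
theorem cut_subset_caps {A : Set (Set Plane)} (hconv : ∀ F ∈ A, Convex ℝ F) {N : Finset Plane}
    (hN : ∀ F ∈ A, ∀ n ∈ N, n ∉ F) {X Y : Plane →ₗ[ℝ] ℝ} (hXY : Coords X Y)
    (hinj : Set.InjOn X N) :
    cut A (hull N) ⊆ A ∪ ((⋃ e ∈ upperEdges X Y N, cap X Y e '' meeting A (segment ℝ e.1 e.2)) ∪
      ⋃ e ∈ upperEdges X (-Y) N, cap X (-Y) e '' meeting A (segment ℝ e.1 e.2)) := by
  rintro _ ⟨F, hF, x, hx, rfl⟩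
  rcases connectedComponentIn_diff_hull (hconv F hF) (hN F hF) hx with h |
    ⟨f, u, hu, v, hv, hfuv, huv, hle, hmeet, hfx, h⟩
  · left; rw [h]; exact hF
  · right
    rw [h]
    clear h
    wlog hlt : X u < X v generalizing u v
    · have hlt' : X v < X u := lt_of_le_of_ne (not_lt.1 hlt) fun h => huv (hinj hv hu h).symm
      have := this v hv u hu hfuv.symm huv.symm (fun n hn => hfuv ▸ hle n hn)
        (segment_symm ℝ u v ▸ hmeet) (hfuv ▸ hfx) hlt'
      rwa [hfuv]
    obtain ⟨c, d, rfl⟩ := hXY.dual f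
    rcases lt_trichotomy d 0 with hd | hd | hd
    · have hneg : c • X + d • Y = c • X + (-d) • (-Y) := by simp
      rw [hneg] at hfuv hle ⊢
      obtain ⟨h1, h2⟩ := Coords.exists_cap (F := F) (neg_pos.2 hd) hu hv hfuv hlt hle
      exact Or.inr (Set.mem_iUnion₂.2 ⟨(u, v), h1, F, ⟨hF, hmeet⟩, h2.symm⟩)
    · exfalso
      simp only [hd, zero_smul, add_zero, LinearMap.smul_apply, smul_eq_mul] at hfuv hfx
      have : c * (X v - X u) = 0 := by linarith
      rcases mul_eq_zero.1 this with h | h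
      · rw [h] at hfx; linarith
      · linarith
    · obtain ⟨h1, h2⟩ := Coords.exists_cap (F := F) hd hu hv hfuv hlt hle
      exact Or.inl (Set.mem_iUnion₂.2 ⟨(u, v), h1, F, ⟨hF, hmeet⟩, h2.symm⟩)

/-- A cap is determined by an edge and a face meeting that edge, so the incidences bound the number
of caps. -/
theorem ncard_cut_le {A : Set (Set Plane)} (hA : A.Finite) (hconv : ∀ F ∈ A, Convex ℝ F)
    {N : Finset Plane} (hN : ∀ F ∈ A, ∀ n ∈ N, n ∉ F) {X Y : Plane →ₗ[ℝ] ℝ} (hXY : Coords X Y)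
    (hinj : Set.InjOn X N) :
    (cut A (hull N)).Finite ∧ (∀ G ∈ cut A (hull N), Convex ℝ G) ∧
    (cut A (hull N)).ncard ≤ A.ncard +
      (∑ e ∈ upperEdges X Y N, (meeting A (segment ℝ e.1 e.2)).ncard +
        ∑ e ∈ upperEdges X (-Y) N, (meeting A (segment ℝ e.1 e.2)).ncard) := by
  have hsub := cut_subset_caps hconv hN hXY hinj
  have hfinite : ∀ Z : Plane →ₗ[ℝ] ℝ, (⋃ e ∈ upperEdges X Z N,
      cap X Z e '' meeting A (segment ℝ e.1 e.2)).Finite := fun Z =>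
    (Finset.finite_toSet _).biUnion fun e _ => (finite_meeting hA _).image _
  have hbound : ∀ Z : Plane →ₗ[ℝ] ℝ, (⋃ e ∈ upperEdges X Z N,
      cap X Z e '' meeting A (segment ℝ e.1 e.2)).ncard ≤
      ∑ e ∈ upperEdges X Z N, (meeting A (segment ℝ e.1 e.2)).ncard := fun Z =>
    (Finset.set_ncard_biUnion_le _ _).trans
      (Finset.sum_le_sum fun e _ => Set.ncard_image_le (finite_meeting hA _))
  have hfin := hA.union ((hfinite Y).union (hfinite (-Y)))
  refine ⟨hfin.subset hsub, ?_, ?_⟩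
  · rintro _ ⟨F, hF, x, hx, rfl⟩
    rcases connectedComponentIn_diff_hull (hconv F hF) (hN F hF) hx with h |
      ⟨f, u, hu, v, hv, hfuv, huv, hle, hmeet, hfx, h⟩
    · rw [h]; exact hconv F hF
    · rw [h]; exact (hconv F hF).inter (convex_halfSpace_gt f.isLinear (f u))
  · refine (Set.ncard_le_ncard hsub hfin).trans ((Set.ncard_union_le _ _).trans ?_)
    exact Nat.add_le_add_left ((Set.ncard_union_le _ _).trans
      (Nat.add_le_add (hbound Y) (hbound (-Y)))) _

/-! ### Properties of overlap-greedy -/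

variable {k : ℕ} {S : Finset Plane} {color : Plane → Fin k}

theorem mem_covered {L : List (Finset Plane)} {p : Plane} :
    p ∈ covered S L ↔ p ∈ S ∧ ∃ I ∈ L, p ∈ I := by
  simp [covered]

theorem mem_covered_append {L : List (Finset Plane)} {I : Finset Plane} {p : Plane} :
    p ∈ covered S (L ++ [I]) ↔ p ∈ covered S L ∨ (p ∈ S ∧ p ∈ I) := by
  simp only [mem_covered, List.mem_append, List.mem_singleton]
  constructor
  · rintro ⟨hp, J, hJ | rfl, hpJ⟩
    · exact Or.inl ⟨hp, J, hJ, hpJ⟩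
    · exact Or.inr ⟨hp, hpJ⟩
  · rintro (⟨hp, J, hJ, hpJ⟩ | ⟨hp, hpJ⟩)
    · exact ⟨hp, J, Or.inl hJ, hpJ⟩
    · exact ⟨hp, I, Or.inr rfl, hpJ⟩

theorem covered_subset {L : List (Finset Plane)} : covered S L ⊆ S :=
  fun _ h => (mem_covered.1 h).1

theorem hull_mono {I J : Finset Plane} (h : I ⊆ J) : hull I ⊆ hull J :=
  convexHull_mono (Finset.coe_subset.2 h)

theorem IsIsland.mem_of_mem_hull {I : Finset Plane} (h : IsIsland S color I) {p : Plane}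
    (hp : p ∈ S) (hpI : p ∈ hull I) : p ∈ I := by
  have : p ∈ (I : Set Plane) := by rw [← h.hull_inter]; exact ⟨hpI, hp⟩
  exact Finset.mem_coe.1 this

open Classical in
theorem isIsland_filter_hull {K : Finset Plane}
    (hmono : ∀ p ∈ S, p ∈ hull K → ∀ q ∈ S, q ∈ hull K → color p = color q) :
    IsIsland S color (S.filter (fun p => p ∈ hull K)) where
  subset := Finset.filter_subset _ _
  hull_inter := by
    ext p
    constructor
    · rintro ⟨hp, hpS⟩
      refine Finset.mem_coe.2 (Finset.mem_filter.2 ⟨hpS, ?_⟩)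
      exact convexHull_min (fun q hq => (Finset.mem_filter.1 (Finset.mem_coe.1 hq)).2)
        (convex_hull K) hp
    · intro hp
      exact ⟨mem_hull_of_mem (Finset.mem_coe.1 hp), (Finset.mem_filter.1 (Finset.mem_coe.1 hp)).1⟩
  monochromatic p hp q hq := by
    rw [Finset.mem_filter] at hp hq
    exact hmono p hp.1 hp.2 q hq.1 hq.2

theorem hull_singleton (p : Plane) : hull {p} = {p} := by simp [hull]

theorem isIsland_singleton {p : Plane} (hp : p ∈ S) : IsIsland S color {p} where
  subset := Finset.singleton_subset_iff.2 hp
  hull_inter := by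
    rw [hull_singleton, Finset.coe_singleton]
    exact Set.inter_eq_left.2 (Set.singleton_subset_iff.2 hp)
  monochromatic a ha b hb := by
    rw [Finset.mem_singleton.1 ha, Finset.mem_singleton.1 hb]

/-- The points of `S` in the hull of `I \ U` form an island with the same new points; the tie-break
for fewest old points forces it to be all of `I`. -/
theorem IsGreedyChoice.hull_diff {U I : Finset Plane} (h : IsGreedyChoice S color U I) :
    hull (I \ U) = hull I := by
  classical
  refine Set.Subset.antisymm (hull_mono Finset.sdiff_subset) ?_
  set J := S.filter (fun p => p ∈ hull (I \ U)) with hJ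
  have hJI : J ⊆ I := fun p hp => by
    rw [hJ, Finset.mem_filter] at hp
    exact h.isIsland.mem_of_mem_hull hp.1 (hull_mono Finset.sdiff_subset hp.2)
  have hJisl : IsIsland S color J := isIsland_filter_hull fun p hp hpK q hq hqK =>
    h.isIsland.monochromatic _ (hJI (Finset.mem_filter.2 ⟨hp, hpK⟩)) _
      (hJI (Finset.mem_filter.2 ⟨hq, hqK⟩))
  have hIJ : I \ U ⊆ J := fun p hp => Finset.mem_filter.2
    ⟨h.isIsland.subset (Finset.mem_sdiff.1 hp).1, mem_hull_of_mem hp⟩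
  have hdiff : J \ U = I \ U := Finset.Subset.antisymm (Finset.sdiff_subset_sdiff hJI le_rfl)
    fun p hp => Finset.mem_sdiff.2 ⟨hIJ hp, (Finset.mem_sdiff.1 hp).2⟩
  have hint : J ∩ U = I ∩ U := Finset.eq_of_subset_of_card_le
    (Finset.inter_subset_inter_right hJI) (h.min_old J hJisl (by rw [hdiff]))
  have : I ⊆ J := fun p hp => by
    by_cases hpU : p ∈ U
    · exact (Finset.mem_inter.1 (hint ▸ Finset.mem_inter.2 ⟨hp, hpU⟩)).1
    · exact hIJ (Finset.mem_sdiff.2 ⟨hp, hpU⟩)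
  refine (hull_mono this).trans (convexHull_min (fun q hq => ?_) (convex_hull _))
  exact (Finset.mem_filter.1 (Finset.mem_coe.1 hq)).2

open Classical in
/-- A greedy island cannot be extended by an uncovered point. -/
theorem IsGreedyChoice.exists_obstruction {U I : Finset Plane} (h : IsGreedyChoice S color U I)
    {b : Plane} (hb : b ∈ S) (hbU : b ∉ U) (hbI : b ∉ I) :
    ∃ w ∈ S, w ∈ hull (insert b I) ∧ ∀ a ∈ I, color w ≠ color a := by
  by_contra! hcon
  have hisl := isIsland_filter_hull (S := S) (color := color) (K := insert b I)
    (fun p hp hpK q hq hqK => by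
      obtain ⟨a, ha, hpa⟩ := hcon p hp hpK
      obtain ⟨a', ha', hqa⟩ := hcon q hq hqK
      rw [hpa, hqa, h.isIsland.monochromatic a ha a' ha'])
  refine absurd (h.max_new _ hisl) (not_le.2 (Finset.card_lt_card ?_))
  have hsub : insert b I ⊆ S.filter (fun p => p ∈ hull (insert b I)) := fun p hp =>
    Finset.mem_filter.2 ⟨by
      rcases Finset.mem_insert.1 hp with rfl | hp
      · exact hb
      · exact h.isIsland.subset hp, mem_hull_of_mem hp⟩
  rw [Finset.ssubset_iff_of_subset (Finset.sdiff_subset_sdiff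
    ((Finset.subset_insert b I).trans hsub) le_rfl)]
  exact ⟨b, Finset.mem_sdiff.2 ⟨hsub (Finset.mem_insert_self b I), hbU⟩,
    fun hb' => hbI (Finset.mem_sdiff.1 hb').1⟩

theorem exists_isGreedyChoice (hS : S.Nonempty) (color : Plane → Fin k) (U : Finset Plane) :
    ∃ I, IsGreedyChoice S color U I := by
  classical
  obtain ⟨p, hp⟩ := hS
  have hmem : ∀ J, IsIsland S color J → J ∈ S.powerset.filter (IsIsland S color) := fun J hJ =>
    Finset.mem_filter.2 ⟨Finset.mem_powerset.2 hJ.subset, hJ⟩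
  obtain ⟨M, hM, hMmax⟩ := Finset.exists_max_image (S.powerset.filter (IsIsland S color))
    (fun J => (J \ U).card) ⟨_, hmem _ (isIsland_singleton hp)⟩
  obtain ⟨I, hI, hImin⟩ := Finset.exists_min_image
    ((S.powerset.filter (IsIsland S color)).filter (fun J => (J \ U).card = (M \ U).card))
    (fun J => (J ∩ U).card) ⟨M, Finset.mem_filter.2 ⟨hM, rfl⟩⟩
  rw [Finset.mem_filter] at hI
  refine ⟨I, (Finset.mem_filter.1 hI.1).2, fun J hJ => ?_, fun J hJ hJI => ?_⟩
  · rw [hI.2]; exact hMmax J (hmem J hJ)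
  · exact hImin J (Finset.mem_filter.2 ⟨hmem J hJ, hJI.trans hI.2⟩)

theorem IsGreedyChoice.one_le_card_diff {U I : Finset Plane} (h : IsGreedyChoice S color U I)
    (hUS : U ⊆ S) (hU : U ≠ S) : 1 ≤ (I \ U).card := by
  classical
  obtain ⟨p, hp, hpU⟩ := Finset.exists_of_ssubset (hUS.ssubset_of_ne hU)
  have := h.max_new {p} (isIsland_singleton hp)
  rwa [Finset.sdiff_eq_self_of_disjoint (Finset.disjoint_singleton_left.2 hpU),
    Finset.card_singleton] at this

theorem sdiff_covered_append {L : List (Finset Plane)} {I : Finset Plane} :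
    S \ covered S (L ++ [I]) = (S \ covered S L) \ I := by
  classical
  ext p
  simp only [Finset.mem_sdiff, mem_covered_append]
  tauto

theorem IsGreedyChoice.card_sdiff_covered {L : List (Finset Plane)} {I : Finset Plane}
    (h : IsGreedyChoice S color (covered S L) I) :
    (S \ covered S (L ++ [I])).card + (I \ covered S L).card = (S \ covered S L).card := by
  classical
  have hI : I \ covered S L = (S \ covered S L) ∩ I := by
    ext p
    simp only [Finset.mem_sdiff, Finset.mem_inter]
    exact ⟨fun hp => ⟨⟨h.isIsland.subset hp.1, hp.2⟩, hp.1⟩, fun hp => ⟨hp.2, hp.1.2⟩⟩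
  rw [sdiff_covered_append, hI]
  exact Finset.card_sdiff_add_card_inter _ _

theorem exists_overlapGreedyReturns (color : Plane → Fin k) (S : Finset Plane) :
    ∃ L, OverlapGreedyReturns S color L := by
  classical
  suffices ∀ n L, OverlapGreedyRun S color L → (S \ covered S L).card ≤ n →
      ∃ L, OverlapGreedyReturns S color L from this _ [] .start le_rfl
  intro n
  induction n with
  | zero =>
    intro L hL h0
    refine ⟨L, hL, Finset.Subset.antisymm covered_subset ?_⟩
    rwa [Nat.le_zero, Finset.card_eq_zero, Finset.sdiff_eq_empty_iff_subset] at h0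
  | succ n ih =>
    intro L hL hn
    by_cases hc : covered S L = S
    · exact ⟨L, hL, hc⟩
    · have hSn : S.Nonempty := by
        rw [Finset.nonempty_iff_ne_empty]
        rintro rfl
        exact hc (Finset.subset_empty.1 covered_subset)
      obtain ⟨I, hI⟩ := exists_isGreedyChoice hSn color (covered S L)
      refine ih _ (.step L I hL hc hI) ?_
      have h1 := hI.one_le_card_diff covered_subset hc
      have h2 := hI.card_sdiff_covered
      omega

theorem IsIslandPartition.card_uncovered_le {P : Finset (Finset Plane)}
    (hP : IsIslandPartition S color P) {U I : Finset Plane} (h : IsGreedyChoice S color U I) :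
    (S \ U).card ≤ P.card * (I \ U).card := by
  classical
  have hsub : S \ U ⊆ P.biUnion (fun J => J \ U) := fun p hp => by
    obtain ⟨J, hJ, hpJ⟩ := hP.covers p (Finset.mem_sdiff.1 hp).1
    exact Finset.mem_biUnion.2 ⟨J, hJ, Finset.mem_sdiff.2 ⟨hpJ, (Finset.mem_sdiff.1 hp).2⟩⟩
  exact (Finset.card_le_card hsub).trans
    (Finset.card_biUnion_le_card_mul _ _ _ fun J hJ => h.max_new J (hP.isIsland J hJ))

theorem IsIslandPartition.one_le_card {P : Finset (Finset Plane)}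
    (hP : IsIslandPartition S color P) (hS : S.Nonempty) : 1 ≤ P.card := by
  obtain ⟨p, hp⟩ := hS
  obtain ⟨J, hJ, -⟩ := hP.covers p hp
  exact Finset.card_pos.2 ⟨J, hJ⟩

/-- Each step covers at least a `1 / P.card` fraction of the uncovered points. -/
theorem OverlapGreedyRun.card_uncovered_le {P : Finset (Finset Plane)}
    (hP : IsIslandPartition S color P) (hr : 1 ≤ P.card) {L : List (Finset Plane)}
    (hL : OverlapGreedyRun S color L) :
    ((S \ covered S L).card : ℝ) ≤ S.card * (1 - 1 / (P.card : ℝ)) ^ L.length := by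
  have hr' : (1 : ℝ) ≤ P.card := by exact_mod_cast hr
  induction hL with
  | start => simpa using Finset.card_le_card Finset.sdiff_subset
  | step L I hL hc hI ih =>
    have h1 : ((S \ covered S (L ++ [I])).card : ℝ) + (I \ covered S L).card =
        (S \ covered S L).card := by exact_mod_cast hI.card_sdiff_covered
    have h2 : ((S \ covered S L).card : ℝ) ≤ P.card * (I \ covered S L).card := by
      exact_mod_cast hP.card_uncovered_le hI
    have h3 : ((S \ covered S L).card : ℝ) / P.card ≤ (I \ covered S L).card := by
      rw [div_le_iff₀ (by linarith)]; linarith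
    have h4 : (0 : ℝ) ≤ 1 - 1 / P.card := by
      rw [sub_nonneg, div_le_one (by linarith)]; exact hr'
    have h5 := mul_le_mul_of_nonneg_right ih h4
    rw [List.length_append, List.length_singleton, pow_succ, ← mul_assoc]
    refine le_trans ?_ h5
    rw [mul_sub, mul_one, mul_one_div]
    linarith

/-- Overlap-greedy is a logarithmic approximation of the smallest island cover. -/
theorem OverlapGreedyRun.length_le {P : Finset (Finset Plane)}
    (hP : IsIslandPartition S color P) (hS : S.Nonempty) {L : List (Finset Plane)}
    (hL : OverlapGreedyRun S color L) :
    (L.length : ℝ) ≤ P.card * Real.log S.card + 1 := by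
  have hr := hP.one_le_card hS
  have hr' : (1 : ℝ) ≤ P.card := by exact_mod_cast hr
  have hn : (1 : ℝ) ≤ S.card := by exact_mod_cast Finset.card_pos.2 hS
  cases hL with
  | start =>
    have := mul_nonneg (zero_le_one.trans hr') (Real.log_nonneg hn)
    simp only [List.length_nil, Nat.cast_zero]
    linarith
  | step L I hL hc hI =>
    -- Some point is uncovered before the last choice, so the decay `exp (-l / r)` bounds the number
    -- `l` of earlier choices; the last one accounts for the `+ 1`.
    have h1 : (1 : ℝ) ≤ (S \ covered S L).card := by
      have h2 := hI.one_le_card_diff covered_subset hc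
      have h3 := hI.card_sdiff_covered
      have : 1 ≤ (S \ covered S L).card := by omega
      exact_mod_cast this
    have h2 := h1.trans (hL.card_uncovered_le hP hr)
    have h3 : (1 - 1 / (P.card : ℝ)) ^ L.length ≤ Real.exp (-(1 / (P.card : ℝ))) ^ L.length := by
      refine pow_le_pow_left₀ ?_ ?_ _
      · rw [sub_nonneg, div_le_one (by linarith)]; exact hr'
      · linarith [Real.add_one_le_exp (-(1 / (P.card : ℝ)))]
    rw [← Real.exp_nat_mul] at h3
    have h4 : (1 : ℝ) ≤ S.card * Real.exp (L.length * -(1 / (P.card : ℝ))) :=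
      h2.trans (mul_le_mul_of_nonneg_left h3 (by linarith))
    have h5 := Real.log_le_log one_pos h4
    rw [Real.log_one, Real.log_mul (by linarith) (Real.exp_ne_zero _), Real.log_exp] at h5
    have h6 : (L.length : ℝ) / P.card ≤ Real.log S.card := by
      have : (L.length : ℝ) * -(1 / (P.card : ℝ)) = -((L.length : ℝ) / P.card) := by ring
      linarith
    rw [div_le_iff₀ (by linarith)] at h6
    rw [List.length_append, List.length_singleton, Nat.cast_add, Nat.cast_one]
    linarith

/-! ### Faces of the bold arrangement -/

theorem boldArrangement_append (L : List (Finset Plane)) (I : Finset Plane) :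
    boldArrangement (L ++ [I]) = boldAugment (boldArrangement L) I := by
  simp [boldArrangement]

theorem OverlapGreedyRun.isIsland {L : List (Finset Plane)} (hL : OverlapGreedyRun S color L) :
    ∀ A ∈ L, IsIsland S color A := by
  induction hL with
  | start => simp
  | step L I hL hc hI ih =>
    intro A hA
    rcases List.mem_append.1 hA with hA | hA
    · exact ih A hA
    · rw [List.mem_singleton.1 hA]; exact hI.isIsland

-- A point that is uncovered now was uncovered when `A` was chosen, so the obstruction found then
-- persists.
open Classical in
theorem OverlapGreedyRun.exists_obstruction {L : List (Finset Plane)}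
    (hL : OverlapGreedyRun S color L) : ∀ A ∈ L, ∀ b ∈ S, b ∉ covered S L →
      ∃ w ∈ S, w ∈ hull (insert b A) ∧ ∀ a ∈ A, color w ≠ color a := by
  induction hL with
  | start => simp
  | step L I hL hc hI ih =>
    intro A hA b hb hbU
    rw [mem_covered_append, not_or] at hbU
    rcases List.mem_append.1 hA with hA | hA
    · exact ih A hA b hb hbU.1
    · rw [List.mem_singleton.1 hA]
      exact hI.exists_obstruction hb hbU.1 fun h => hbU.2 ⟨hb, h⟩

theorem OverlapGreedyRun.notMem_hull {L : List (Finset Plane)} (hL : OverlapGreedyRun S color L)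
    {A : Finset Plane} (hA : A ∈ L) {b : Plane} (hb : b ∈ S) (hbU : b ∉ covered S L) :
    b ∉ hull A := fun h =>
  hbU (mem_covered.2 ⟨hb, A, hA, (hL.isIsland A hA).mem_of_mem_hull hb h⟩)

/-- This keeps new points out of old faces and later makes extracted sets monochromatic. -/
theorem OverlapGreedyRun.face_subset {L : List (Finset Plane)} (hL : OverlapGreedyRun S color L) :
    ∀ F ∈ boldArrangement L, ∃ A ∈ L, F ⊆ hull A := by
  induction hL with
  | start => simp [boldArrangement]
  | step L I hL hc hI ih =>
    rw [boldArrangement_append, boldAugment_eq]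
    rintro G (hG | ⟨F, hF, x, hx, rfl⟩)
    · rw [Set.mem_singleton_iff.1 hG]
      exact ⟨I, by simp, intrinsicInterior_subset⟩
    · obtain ⟨A, hA, hFA⟩ := ih F hF
      exact ⟨A, List.mem_append_left _ hA,
        ((connectedComponentIn_subset _ _).trans Set.sdiff_subset).trans hFA⟩

theorem OverlapGreedyRun.pairwiseDisjoint {L : List (Finset Plane)}
    (hL : OverlapGreedyRun S color L) : (boldArrangement L).PairwiseDisjoint id := by
  induction hL with
  | start => simp [boldArrangement]
  | step L I hL hc hI ih =>
    rw [boldArrangement_append, boldAugment_eq]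
    have hnew : ∀ F ∈ boldArrangement L, ∀ x,
        Disjoint (intrinsicInterior ℝ (hull I)) (connectedComponentIn (F \ hull I) x) :=
      fun F _ x => Set.disjoint_left.2 fun z hz hz' =>
        (connectedComponentIn_subset _ _ hz').2 (intrinsicInterior_subset hz)
    rintro G (hG | ⟨F, hF, x, hx, rfl⟩) G' (hG' | ⟨F', hF', x', hx', rfl⟩) hne
    · exact absurd ((Set.mem_singleton_iff.1 hG).trans (Set.mem_singleton_iff.1 hG').symm) hne
    · rw [Set.mem_singleton_iff.1 hG]
      exact hnew F' hF' x'
    · rw [Set.mem_singleton_iff.1 hG']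
      exact (hnew F hF x).symm
    · simp only [Function.onFun, id]
      rw [Set.disjoint_left]
      intro z hz hz'
      by_cases hFF : F = F'
      · subst hFF
        exact hne ((connectedComponentIn_eq hz).trans (connectedComponentIn_eq hz').symm)
      · exact Set.disjoint_left.1 (ih hF hF' hFF) (connectedComponentIn_subset _ _ hz).1
          (connectedComponentIn_subset _ _ hz').1

theorem OverlapGreedyRun.new_notMem_face {L : List (Finset Plane)}
    (hL : OverlapGreedyRun S color L) {I : Finset Plane}
    (hI : IsGreedyChoice S color (covered S L) I) :
    ∀ F ∈ boldArrangement L, ∀ n ∈ I \ covered S L, n ∉ F := by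
  intro F hF n hn hnF
  obtain ⟨A, hA, hFA⟩ := hL.face_subset F hF
  rw [Finset.mem_sdiff] at hn
  exact hL.notMem_hull hA (hI.isIsland.subset hn.1) hn.2 (hFA hnF)

/-- The new hull is spanned by points outside all faces, so a surviving piece is a whole face or its
intersection with a half-plane. -/
theorem OverlapGreedyRun.finite_and_convex {L : List (Finset Plane)}
    (hL : OverlapGreedyRun S color L) :
    (boldArrangement L).Finite ∧ ∀ F ∈ boldArrangement L, Convex ℝ F := by
  obtain ⟨X, Y, hXY, hinj⟩ := exists_coords S
  induction hL with
  | start => simp [boldArrangement]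
  | step L I hL hc hI ih =>
    have hsub : I \ covered S L ⊆ S := Finset.sdiff_subset.trans hI.isIsland.subset
    have hcut := ncard_cut_le ih.1 ih.2 (hL.new_notMem_face hI) hXY
      (hinj.mono (Finset.coe_subset.2 hsub))
    rw [hI.hull_diff] at hcut
    rw [boldArrangement_append, boldAugment_eq]
    refine ⟨(Set.finite_singleton _).union hcut.1, ?_⟩
    rintro F (hF | hF)
    · rw [Set.mem_singleton_iff.1 hF]; exact convex_intrinsicInterior (convex_hull I)
    · exact hcut.2.1 F hF

open Classical in
/-- The number of faces along a segment is at most twice the number of islands whose hulls meet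
the segment. -/
theorem OverlapGreedyRun.ncard_meeting_le {L : List (Finset Plane)}
    (hL : OverlapGreedyRun S color L) (u v : Plane) :
    (meeting (boldArrangement L) (segment ℝ u v)).ncard ≤
      2 * L.countP (fun A => (segment ℝ u v ∩ hull A).Nonempty) := by
  induction hL with
  | start => simp [boldArrangement, meeting]
  | step L I hL hc hI ih =>
    obtain ⟨h1, h2⟩ := ncard_meeting_boldAugment_le hL.finite_and_convex.1
      hL.finite_and_convex.2 hL.pairwiseDisjoint I u v
    rw [boldArrangement_append, List.countP_append]
    by_cases h : (segment ℝ u v ∩ hull I).Nonempty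
    · simp only [List.countP_singleton, h, decide_true, if_true]
      omega
    · have := h2 h
      omega

theorem sum_countP_le {ι α : Type*} (T : Finset ι) (p : ι → α → Prop)
    [∀ i a, Decidable (p i a)] {K : ℕ} (L : List α)
    (h : ∀ a ∈ L, (T.filter (fun i => p i a)).card ≤ K) :
    ∑ i ∈ T, L.countP (fun a => p i a) ≤ L.length * K := by
  induction L with
  | nil => simp
  | cons a L ih =>
    simp only [List.countP_cons, Finset.sum_add_distrib, List.length_cons]
    have h1 := ih fun b hb => h b (List.mem_cons_of_mem a hb)
    have h2 := h a List.mem_cons_self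
    rw [Finset.card_filter] at h2
    simp only [decide_eq_true_eq]
    rw [Nat.succ_mul]
    exact Nat.add_le_add h1 h2

/-- The bold arrangement has few faces. -/
theorem OverlapGreedyRun.ncard_faces_le {P : Finset (Finset Plane)}
    (hP : IsIslandPartition S color P) (hS : GeneralPosition S) {L : List (Finset Plane)}
    (hL : OverlapGreedyRun S color L) :
    (boldArrangement L).ncard ≤ L.length + 4 * (2 * P.card + 1) * L.length ^ 2 := by
  classical
  obtain ⟨X, Y, hXY, hinj⟩ := exists_coords S
  induction hL with
  | start => simp [boldArrangement]
  | step L I hL hc hI ih =>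
    have hsub : I \ covered S L ⊆ S := Finset.sdiff_subset.trans hI.isIsland.subset
    have hcut := (ncard_cut_le hL.finite_and_convex.1 hL.finite_and_convex.2
      (hL.new_notMem_face hI) hXY (hinj.mono (Finset.coe_subset.2 hsub))).2.2
    rw [hI.hull_diff] at hcut
    -- Exchange the count: instead of hulls met by each edge, sum over earlier islands the edges
    -- meeting its hull. The factor 2 is faces per hull; upper and lower edges together make it 4.
    have hsum : ∀ Z : Plane →ₗ[ℝ] ℝ, Coords X Z →
        ∑ e ∈ upperEdges X Z (I \ covered S L),
          (meeting (boldArrangement L) (segment ℝ e.1 e.2)).ncard ≤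
        2 * (L.length * (2 * P.card + 1)) := by
      intro Z hXZ
      refine (Finset.sum_le_sum fun e _ => hL.ncard_meeting_le e.1 e.2).trans ?_
      rw [← Finset.mul_sum]
      refine Nat.mul_le_mul_left 2 (sum_countP_le _
        (fun (e : Plane × Plane) A => (segment ℝ e.1 e.2 ∩ hull A).Nonempty) L fun A hA => ?_)
      refine card_upperEdges_meeting_le hP hS hXZ hsub (hL.isIsland A hA)
        (fun n hn => ?_) (fun n hn => ?_)
      · rw [Finset.mem_sdiff] at hn
        exact hL.notMem_hull hA (hI.isIsland.subset hn.1) hn.2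
      · rw [Finset.mem_sdiff] at hn
        exact hL.exists_obstruction A hA n (hI.isIsland.subset hn.1) hn.2
    have h1 := hsum Y hXY
    have h2 := hsum (-Y) hXY.neg
    have h3 := Set.ncard_union_le {intrinsicInterior ℝ (hull I)} (cut (boldArrangement L) (hull I))
    rw [Set.ncard_singleton] at h3
    rw [boldArrangement_append, boldAugment_eq, List.length_append, List.length_singleton]
    refine h3.trans ((Nat.add_le_add_left (hcut.trans
      (Nat.add_le_add ih (Nat.add_le_add h1 h2))) 1).trans ?_)
    -- With `l` earlier islands, the step adds at most `1 + 4 (2 r + 1) l` faces, and `l² + l ≤ (l +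
    -- 1)²`.
    nlinarith [Nat.zero_le L.length, Nat.zero_le (L.length * P.card), Nat.zero_le P.card]

/-- Near a point outside the new hull nothing is lost: a small ball misses the hull, and its part in
`F` is convex, hence within one component. -/
theorem OverlapGreedyRun.exists_face {L : List (Finset Plane)} (hL : OverlapGreedyRun S color L) :
    ∀ p ∈ covered S L, ∃ F ∈ boldArrangement L, p ∈ closure F := by
  induction hL with
  | start => simp [covered]
  | step L I hL hc hI ih =>
    intro p hp
    rw [boldArrangement_append, boldAugment_eq]
    by_cases hpI : p ∈ I
    · exact ⟨_, Or.inl rfl, subset_closure_intrinsicInterior (convex_hull I) (mem_hull_of_mem hpI)⟩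
    · have hpS : p ∈ S := covered_subset hp
      have hpL : p ∈ covered S L := (mem_covered_append.1 hp).resolve_right fun h => hpI h.2
      obtain ⟨F, hF, hpF⟩ := ih p hpL
      have hpH : p ∈ (hull I)ᶜ := fun h => hpI (hI.isIsland.mem_of_mem_hull hpS h)
      obtain ⟨ε, hε, hball⟩ := Metric.isOpen_iff.1 (isClosed_hull I).isOpen_compl p hpH
      have hcl : p ∈ closure (Metric.ball p ε ∩ F) :=
        Metric.isOpen_ball.inter_closure ⟨Metric.mem_ball_self hε, hpF⟩
      obtain ⟨x, hx⟩ := closure_nonempty_iff.1 ⟨p, hcl⟩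
      have hsub : Metric.ball p ε ∩ F ⊆ F \ hull I := fun z hz => ⟨hz.2, hball hz.1⟩
      have hconv : Convex ℝ (Metric.ball p ε ∩ F) :=
        (convex_ball p ε).inter (hL.finite_and_convex.2 F hF)
      exact ⟨_, Or.inr ⟨F, hF, x, hsub hx, rfl⟩, closure_mono
        (hconv.isPreconnected.subset_connectedComponentIn hx hsub) hcl⟩

/-! ### Correctness and size of the output -/

theorem exists_isIslandPartition (S : Finset Plane) (color : Plane → Fin k) :
    ∃ P, IsIslandPartition S color P := by
  classical
  refine ⟨S.image fun p => {p}, ⟨?_, ?_, ?_, fun p hp =>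
    ⟨{p}, Finset.mem_image_of_mem _ hp, Finset.mem_singleton_self p⟩⟩⟩
  · intro I hI
    obtain ⟨p, hp, rfl⟩ := Finset.mem_image.1 hI
    exact isIsland_singleton hp
  · intro I hI
    obtain ⟨p, hp, rfl⟩ := Finset.mem_image.1 hI
    exact Finset.singleton_nonempty p
  · intro I hI J hJ hne
    obtain ⟨p, hp, rfl⟩ := Finset.mem_image.1 hI
    obtain ⟨q, hq, rfl⟩ := Finset.mem_image.1 hJ
    rw [hull_singleton, hull_singleton, Set.disjoint_singleton]
    rintro rfl
    exact hne rfl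

theorem exists_optimal_partition (S : Finset Plane) (color : Plane → Fin k) :
    ∃ P, IsIslandPartition S color P ∧ P.card = optPartition S color := by
  obtain ⟨P, hP⟩ := exists_isIslandPartition S color
  exact Nat.sInf_mem
    (s := {r : ℕ | ∃ P : Finset (Finset Plane), IsIslandPartition S color P ∧ P.card = r})
    ⟨_, P, hP, rfl⟩

/-- Points of a set in general position that are assigned to the closures of two disjoint convex
sets have disjoint hulls. -/
theorem GeneralPosition.disjoint_hull (hS : GeneralPosition S) {F G : Set Plane}
    (hF : Convex ℝ F) (hG : Convex ℝ G) (hFG : Disjoint F G) {I J : Finset Plane} (hI : I ⊆ S)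
    (hJ : J ⊆ S) (hIJ : Disjoint I J) (hIF : ∀ p ∈ I, p ∈ closure F)
    (hJG : ∀ p ∈ J, p ∈ closure G) : Disjoint (hull I) (hull J) := by
  classical
  rw [Set.disjoint_left]
  intro z hzI hzJ
  obtain ⟨i, hi⟩ := Finset.coe_nonempty.1 (convexHull_nonempty_iff.1 ⟨z, hzI⟩)
  obtain ⟨j, hj⟩ := Finset.coe_nonempty.1 (convexHull_nonempty_iff.1 ⟨z, hzJ⟩)
  -- The hulls can meet only on the separating line, where each is spanned by its own points there.
  -- With `a` from `I` and `b` from `J` on the line, general position allows no third point, so a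
  -- common point would equal both.
  obtain ⟨f, hf, c, hfF, hfG⟩ := exists_separating hF hG (closure_nonempty_iff.1 ⟨i, hIF i hi⟩)
    (closure_nonempty_iff.1 ⟨j, hJG j hj⟩) hFG
  have hI' : ∀ p ∈ I, f p ≤ c := fun p hp =>
    closure_minimal hfF (isClosed_le f.continuous continuous_const) (hIF p hp)
  have hJ' : ∀ p ∈ J, c ≤ f p := fun p hp =>
    closure_minimal hfG (isClosed_le continuous_const f.continuous) (hJG p hp)
  have h1 : f z ≤ c := map_le_of_mem_convexHull (f := f.toLinearMap) hI' hzI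
  have h2 : (-f.toLinearMap) z ≤ -c := map_le_of_mem_convexHull
    (fun p hp => by simpa using hJ' p hp) hzJ
  have hz : f z = c := le_antisymm h1 (by simpa using h2)
  have hf0 : f.toLinearMap ≠ 0 := fun h => hf (by ext p; exact LinearMap.congr_fun h p)
  have hzI' := convexHull_inter_max (f := f.toLinearMap) hI' hzI hz
  have hzJ' := convexHull_inter_max (f := -f.toLinearMap) (c := -c)
    (fun p hp => by simpa using hJ' p hp) hzJ (by simpa using hz)
  obtain ⟨a, ha, hac⟩ := convexHull_nonempty_iff.1 ⟨z, hzI'⟩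
  obtain ⟨b, hb, hbc⟩ := convexHull_nonempty_iff.1 ⟨z, hzJ'⟩
  have ha : a ∈ I := ha
  have hb : b ∈ J := hb
  have hac : f a = c := hac
  have hbc : f b = c := by simpa using hbc
  have hab : a ≠ b := by rintro rfl; exact Finset.disjoint_left.1 hIJ ha hb
  have hsubI : {n ∈ (I : Set Plane) | f.toLinearMap n = c} ⊆ {a} := by
    rintro n ⟨hn, hnc⟩
    have hn : n ∈ I := hn
    have hnc : f n = c := hnc
    rcases hS.eq_or_eq hf0 (hI ha) (hJ hb) (hI hn) hab (hac.trans hbc.symm) (hnc.trans hbc.symm)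
      with h | h
    · exact h
    · exact absurd hb (Finset.disjoint_left.1 hIJ (h ▸ hn))
  have hsubJ : {n ∈ (J : Set Plane) | (-f.toLinearMap) n = -c} ⊆ {b} := by
    rintro n ⟨hn, hnc⟩
    have hn : n ∈ J := hn
    have hnc : f n = c := by simpa using hnc
    rcases hS.eq_or_eq hf0 (hI ha) (hJ hb) (hJ hn) hab (hac.trans hbc.symm) (hnc.trans hbc.symm)
      with h | h
    · exact absurd (h ▸ hn) (Finset.disjoint_left.1 hIJ ha)
    · exact h
  have hza := convexHull_mono (𝕜 := ℝ) hsubI hzI'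
  have hzb := convexHull_mono (𝕜 := ℝ) hsubJ hzJ'
  rw [convexHull_singleton, Set.mem_singleton_iff] at hza hzb
  exact hab (hza.symm.trans hzb)

theorem BoldOverlapGreedyReturns.exists (S : Finset Plane) (color : Plane → Fin k) :
    ∃ P, BoldOverlapGreedyReturns S color P := by
  classical
  obtain ⟨L, hL, hc⟩ := exists_overlapGreedyReturns color S
  have h := hL.exists_face
  rw [hc] at h
  choose! f hfA hf using h
  exact ⟨_, L, ⟨hL, hc⟩, f, fun p hp => ⟨hfA p hp, hf p hp⟩, rfl⟩

theorem BoldOverlapGreedyReturns.isIslandPartition {P : Finset (Finset Plane)}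
    (hS : GeneralPosition S) (h : BoldOverlapGreedyReturns S color P) :
    IsIslandPartition S color P := by
  classical
  obtain ⟨L, ⟨hL, -⟩, f, hf, rfl⟩ := h
  have hdisj : ∀ p ∈ S, ∀ q ∈ S, f p ≠ f q →
      Disjoint (hull (S.filter fun x => f x = f p)) (hull (S.filter fun x => f x = f q)) := by
    intro p hp q hq hpq
    refine hS.disjoint_hull (hL.finite_and_convex.2 _ (hf p hp).1)
      (hL.finite_and_convex.2 _ (hf q hq).1) (hL.pairwiseDisjoint (hf p hp).1 (hf q hq).1 hpq)
      (Finset.filter_subset _ _) (Finset.filter_subset _ _) ?_ ?_ ?_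
    · rw [Finset.disjoint_left]
      intro x hx hx'
      exact hpq ((Finset.mem_filter.1 hx).2.symm.trans (Finset.mem_filter.1 hx').2)
    · intro x hx
      rw [Finset.mem_filter] at hx
      exact hx.2 ▸ (hf x hx.1).2
    · intro x hx
      rw [Finset.mem_filter] at hx
      exact hx.2 ▸ (hf x hx.1).2
  refine ⟨?_, ?_, ?_, ?_⟩
  · intro I hI
    obtain ⟨p, hp, rfl⟩ := Finset.mem_image.1 hI
    refine ⟨Finset.filter_subset _ _, ?_, ?_⟩
    · ext x
      constructor
      · rintro ⟨hx, hxS⟩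
        refine Finset.mem_coe.2 (Finset.mem_filter.2 ⟨hxS, ?_⟩)
        by_contra hne
        exact Set.disjoint_left.1 (hdisj x hxS p hp hne)
          (mem_hull_of_mem (Finset.mem_filter.2 ⟨hxS, rfl⟩)) hx
      · intro hx
        exact ⟨mem_hull_of_mem (Finset.mem_coe.1 hx),
          (Finset.mem_filter.1 (Finset.mem_coe.1 hx)).1⟩
    · obtain ⟨A, hA, hFA⟩ := hL.face_subset _ (hf p hp).1
      have hmem : ∀ x ∈ S.filter (fun x => f x = f p), x ∈ A := by
        intro x hx
        rw [Finset.mem_filter] at hx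
        refine (hL.isIsland A hA).mem_of_mem_hull hx.1 ?_
        exact closure_minimal hFA (isClosed_hull A) (hx.2 ▸ (hf x hx.1).2)
      exact fun x hx y hy => (hL.isIsland A hA).monochromatic x (hmem x hx) y (hmem y hy)
  · intro I hI
    obtain ⟨p, hp, rfl⟩ := Finset.mem_image.1 hI
    exact ⟨p, Finset.mem_filter.2 ⟨hp, rfl⟩⟩
  · intro I hI J hJ hne
    obtain ⟨p, hp, rfl⟩ := Finset.mem_image.1 hI
    obtain ⟨q, hq, rfl⟩ := Finset.mem_image.1 hJ
    exact hdisj p hp q hq fun h => hne (by simp only [h])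
  · intro p hp
    exact ⟨_, Finset.mem_image_of_mem _ hp, Finset.mem_filter.2 ⟨hp, rfl⟩⟩

theorem BoldOverlapGreedyReturns.card_le {P Q : Finset (Finset Plane)} (hS : GeneralPosition S)
    (hSn : S.Nonempty) (h : BoldOverlapGreedyReturns S color P)
    (hQ : IsIslandPartition S color Q) :
    (P.card : ℝ) ≤ 13 * Q.card * (Q.card * Real.log S.card + 1) ^ 2 := by
  classical
  obtain ⟨L, ⟨hL, -⟩, f, hf, rfl⟩ := h
  have h1 : (S.image fun p => S.filter fun q => f q = f p).card ≤ (S.image f).card := by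
    have : (S.image fun p => S.filter fun q => f q = f p) =
        (S.image f).image fun F => S.filter fun q => f q = F := by
      rw [Finset.image_image]; rfl
    rw [this]
    exact Finset.card_image_le
  have h2 : (S.image f).card ≤ (boldArrangement L).ncard := by
    rw [← Set.ncard_coe_finset]
    refine Set.ncard_le_ncard (fun F hF => ?_) hL.finite_and_convex.1
    obtain ⟨p, hp, rfl⟩ := Finset.mem_image.1 (Finset.mem_coe.1 hF)
    exact (hf p hp).1
  have h3 := (h1.trans h2).trans (hL.ncard_faces_le hQ hS)
  have hr := hQ.one_le_card hSn
  -- The constant is `13 = 1 + 8 + 4`, using `m ≤ m²` and `r ≥ 1`.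
  have h4 : L.length + 4 * (2 * Q.card + 1) * L.length ^ 2 ≤ 13 * Q.card * L.length ^ 2 := by
    have h5 : L.length ≤ L.length ^ 2 := Nat.le_self_pow two_ne_zero _
    have h6 := Nat.mul_le_mul_right (L.length ^ 2) hr
    linarith
  have h5 : ((S.image fun p => S.filter fun q => f q = f p).card : ℝ) ≤
      13 * Q.card * (L.length : ℝ) ^ 2 := by exact_mod_cast h3.trans h4
  refine h5.trans (mul_le_mul_of_nonneg_left ?_ (by positivity))
  exact pow_le_pow_left₀ (by positivity) (hL.length_le hQ hSn) 2

end IslandPartition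

theorem mainTheorem5 :
    ∃ C : ℝ, 0 < C ∧
      ∀ (k : ℕ), 2 ≤ k →
      ∀ (S : Finset IslandPartition.Plane) (color : IslandPartition.Plane → Fin k),
        2 ≤ S.card → IslandPartition.GeneralPosition S →
        (∃ P, IslandPartition.BoldOverlapGreedyReturns S color P) ∧
        ∀ P, IslandPartition.BoldOverlapGreedyReturns S color P →
          IslandPartition.IsIslandPartition S color P ∧
          (P.card : ℝ) ≤
            C * ((IslandPartition.optPartition S color : ℝ) ^ 2 * Real.log (S.card : ℝ) ^ 2) *
              (IslandPartition.optPartition S color : ℝ) := by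
  -- `117 = 13 * 3 ^ 2`: as `r ≥ 1` and `log n ≥ log 2 ≥ 1 / 2`, the additive 1 in `r log n + 1` is
  -- at most `2 r log n`.
  refine ⟨117, by norm_num, fun k _ S color hcard hS =>
    ⟨IslandPartition.BoldOverlapGreedyReturns.exists S color, fun P hP =>
      ⟨hP.isIslandPartition hS, ?_⟩⟩⟩
  have hSn : S.Nonempty := Finset.card_pos.1 (by omega)
  obtain ⟨Q, hQ, hQc⟩ := IslandPartition.exists_optimal_partition S color
  have h := hP.card_le hS hSn hQ
  have hr : (1 : ℝ) ≤ Q.card := by exact_mod_cast hQ.one_le_card hSn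
  rw [← hQc]
  have hlog : 1 / 2 ≤ Real.log S.card := by
    have h1 : Real.log 2 ≤ Real.log S.card :=
      Real.log_le_log two_pos (by exact_mod_cast hcard)
    linarith [Real.log_two_gt_d9]
  have h1 : (Q.card : ℝ) * Real.log S.card + 1 ≤ 3 * (Q.card * Real.log S.card) := by
    have := mul_le_mul hr hlog (by norm_num) (by linarith)
    linarith
  have h2 : ((Q.card : ℝ) * Real.log S.card + 1) ^ 2 ≤ (3 * (Q.card * Real.log S.card)) ^ 2 :=
    pow_le_pow_left₀ (by positivity) h1 2
  refine h.trans ((mul_le_mul_of_nonneg_left h2 (by positivity)).trans (le_of_eq ?_))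
  ring
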